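/- \textbf{Setting.} The reward space is $\mathcal Y=[0,1]$; $\mathcal A$ (actions) is a nonempty finite set and $\mathcal Z$ (post-action contexts) is a finite set. An \emph{environment} is a family $\nu=(\nu_a)_{a\in\mathcal A}$ of probability laws on $\mathcal Z\times\mathcal Y$; $\nu(Z)=(\nu_a(Z))_{a\in\mathcal A}$ denotes its family of context marginals. A \emph{policy} $\pi\in\Pi(\mathcal A,\mathcal Z,T)$ is a sequence of measurable maps $\pi_t:(\mathcal A\times\mathcal Z\times\mathcal Y)^{t-1}\to\mathcal A$, $t=1,\dots,T$. The pairs $(Z_t(a),Y_t(a))\sim\nu_a$ are independent over $t\le T$ and $a\in\mathcal A$, the action in round $t$ is $A_t=\pi_t\big((A_s,Z_s(A_s),Y_s(A_s))_{s<t}\big)$, and the \emph{regret} is $$R_{\nu,\pi}(T)=T\max_{a\in\mathcal A}\mathbb E_{\nu_a}[Y]-\mathbb E_{\nu,\pi}\sum_{t=1}^T\mathbb E_{\nu_{A_t}}[Y].$$ An \emph{algorithm} $\mathfrak a$ is any map that assigns to each $(\mathcal A,\mathcal Z,T,q)$ with $q\in\mathscr P(\mathcal Z)^{\mathcal A}$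 a policy $\mathfrak a(\mathcal A,\mathcal Z,T,q)\in\Pi(\mathcal A,\mathcal Z,T)$. The environment $\nu$ is \emph{conditionally benign} if there is a probability law $p$ on $\mathcal Z\times\mathcal Y$ such that for every $a\in\mathcal A$, $\nu_a(Z)\ll p(Z)$ and $\nu_a(Y\mid Z)=p(Y\mid Z)$ $p$-a.s. (for some versions of the conditional laws). \textbf{Theorem.} (i) For every $C>0$ there are constants $c>0$ and $C'>0$, depending only on $C$, such that the following holds for every algorithm $\mathfrak a$. Suppose that, for all $\mathcal A$, $\mathcal Z$ and $T$, $$\sup_{\nu\in\mathscr P(\mathcal Z\times\mathcal Y)^{\mathcal A}}R_{\nu,\,\mathfrak a(\mathcal A,\mathcal Z,T,\nu(Z))}(T)\le C\sqrt{|\mathcal A|\,T}.$$ Then for all $\mathcal A$ and $\mathcal Z$ with $|\mathcal A|\ge2$ and $|\mathcal Z|\ge2$, and all $T\ge c\,|\mathcal A|$, there is a conditionally benign environment $\nu\in\mathscr P(\mathcal Z\times\mathcal Y)^{\mathcal A}$ with $$R_{\nu,\,\mathfrak a(\mathcal A,\mathcal Z,T,\nu(Z))}(T)\ge C'\sqrt{|\mathcal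 A|\,T}.$$ (ii) No algorithm is adaptively minimax optimal with respect to the conditionally benign property. That is, there is no algorithm $\mathfrak a$ for which there is a constant $C>0$ such that for all $\mathcal A$, $\mathcal Z$, $q\in\mathscr P(\mathcal Z)^{\mathcal A}$ and $T$ both $$\sup_{\nu:\,\nu(Z)=q}R_{\nu,\mathfrak a(\mathcal A,\mathcal Z,T,q)}(T)\le C\inf_{\pi\in\Pi(\mathcal A,\mathcal Z,T)}\ \sup_{\nu:\,\nu(Z)=q}R_{\nu,\pi}(T)$$ and $$\sup_{\substack{\nu:\,\nu(Z)=q\\ \nu\text{ cond. benign}}}R_{\nu,\mathfrak a(\mathcal A,\mathcal Z,T,q)}(T)\le C\inf_{\pi\in\Pi(\mathcal A,\mathcal Z,T)}\ \sup_{\substack{\nu:\,\nu(Z)=q\\ \nu\text{ cond. benign}}}R_{\nu,\pi}(T).$$ -/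

import Mathlib

open MeasureTheory ProbabilityTheory

noncomputable section

namespace CausalBandit

/-- The reward space `[0, 1]`. -/
abbrev Reward : Type := unitInterval

/-- An environment: for every action, a joint law of (post-action context, reward). -/
abbrev Environment (A Z : Type) [MeasurableSpace Z] : Type :=
  A → ProbabilityMeasure (Z × Reward)

/-- A policy with horizon `T`: for each round, a measurable map from the history observed so far
(actions, contexts, rewards of the earlier rounds) to the actions. Rounds are numbered from `0`. -/
structure Policy (A Z : Type) [MeasurableSpace A] [MeasurableSpace Z] (T : ℕ) where
  act : (t : Fin T) → (Fin (t : ℕ) → A × Z × Reward) → A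
  measurable_act : ∀ t, Measurable (act t)

/-- The space of all potential outcomes `(Z_t(a), Y_t(a))`, for rounds `t` and actions `a`. -/
abbrev Outcomes (A Z : Type) (T : ℕ) : Type := Fin T → A → Z × Reward

section Fixed

variable {A Z : Type} [MeasurableSpace A] [MeasurableSpace Z]

/-- The history observed in the first `t` rounds when `π` is played on the outcomes `ω`. -/
def Policy.history {T : ℕ} (π : Policy A Z T) (ω : Outcomes A Z T) :
    (t : ℕ) → t ≤ T → (Fin t → A × Z × Reward)
  | 0, _ => Fin.elim0
  | t + 1, ht =>
      let H := π.history ω t (Nat.le_of_succ_le ht)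
      let a := π.act ⟨t, ht⟩ H
      Fin.snoc (α := fun _ => A × Z × Reward) H (a, ω ⟨t, ht⟩ a)

/-- The action taken by `π` in round `t` on the outcomes `ω`. -/
def Policy.action {T : ℕ} (π : Policy A Z T) (ω : Outcomes A Z T) (t : Fin T) : A :=
  π.act t (π.history ω t t.isLt.le)

/-- The law of the potential outcomes: independent over rounds and actions, with
`(Z_t(a), Y_t(a))` distributed according to `ν a`. -/
def outcomeLaw [Fintype A] (ν : Environment A Z) (T : ℕ) : Measure (Outcomes A Z T) :=
  Measure.pi fun _ => Measure.pi fun a => (ν a : Measure (Z × Reward))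

/-- The mean reward of action `a`. -/
def meanReward (ν : Environment A Z) (a : A) : ℝ :=
  ∫ x, (x.2 : ℝ) ∂(ν a : Measure (Z × Reward))

/-- The expected regret of the policy `π` in the environment `ν`. -/
def regret [Fintype A] [Nonempty A] {T : ℕ} (ν : Environment A Z) (π : Policy A Z T) : ℝ :=
  T * Finset.univ.sup' Finset.univ_nonempty (meanReward ν)
    - ∫ ω, ∑ t : Fin T, meanReward ν (π.action ω t) ∂(outcomeLaw ν T)

/-- The marginal laws of the context, one for each action. -/
def marginals (ν : Environment A Z) : A → ProbabilityMeasure Z :=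
  fun a => ⟨(ν a : Measure (Z × Reward)).fst, inferInstance⟩

/-- `κ` is a version of the conditional law of the reward given the context under `μ`. -/
def IsCondLaw (μ : ProbabilityMeasure (Z × Reward)) (κ : Kernel Z Reward) : Prop :=
  IsMarkovKernel κ ∧ (μ : Measure (Z × Reward)).IsCondKernel κ

/-- The conditionally benign property: for some law `p` of (context, reward) and every action `a`,
`ν_a(Z) ≪ p(Z)` and `ν_a(Y | Z) = p(Y | Z)` `p`-almost surely. Conditional laws are determined
only almost surely, so the equality is between versions of them. -/
def ConditionallyBenign (ν : Environment A Z) : Prop :=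
  ∃ (p : ProbabilityMeasure (Z × Reward)) (κ : Kernel Z Reward), IsCondLaw p κ ∧
    ∀ a, (ν a : Measure (Z × Reward)).fst ≪ (p : Measure (Z × Reward)).fst ∧
      ∃ κa : Kernel Z Reward, IsCondLaw (ν a) κa ∧
        ∀ᵐ z ∂(p : Measure (Z × Reward)).fst, κa z = κ z

end Fixed

/-- An algorithm: a map from the actions, the contexts, the horizon and a family of (approximate)
marginal laws of the context to the policies. -/
def Algorithm : Type 1 :=
  ∀ (A Z : Type) [Fintype A] [Nonempty A] [MeasurableSpace A] [DiscreteMeasurableSpace A]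
    [Fintype Z] [MeasurableSpace Z] [DiscreteMeasurableSpace Z] (T : ℕ),
    (A → ProbabilityMeasure Z) → Policy A Z T

/-- The regret of an algorithm that is given the true marginals `ν(Z)`. -/
def Algorithm.regret (𝔞 : Algorithm) {A Z : Type}
    [Fintype A] [Nonempty A] [MeasurableSpace A] [DiscreteMeasurableSpace A]
    [Fintype Z] [MeasurableSpace Z] [DiscreteMeasurableSpace Z]
    (T : ℕ) (ν : Environment A Z) : ℝ :=
  CausalBandit.regret ν (𝔞 A Z T (marginals ν))

/-- With the true marginals as input, the worst-case regret of `𝔞` is at most `C √(|A| T)`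
for all `A`, `Z`, `T`. -/
def Algorithm.HasWorstCaseBound (𝔞 : Algorithm) (C : ℝ) : Prop :=
  ∀ (A Z : Type) [Fintype A] [Nonempty A] [MeasurableSpace A] [DiscreteMeasurableSpace A]
    [Fintype Z] [MeasurableSpace Z] [DiscreteMeasurableSpace Z] (T : ℕ) (ν : Environment A Z),
    𝔞.regret T ν ≤ C * √((Fintype.card A : ℝ) * T)

/-- A property of environments. -/
abbrev EnvironmentProperty : Type 1 :=
  ∀ (A Z : Type) [MeasurableSpace Z], Environment A Z → Prop

/-- The largest regret of `π` over the environments that have context marginals `q` and the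
property `P`. The regret always lies in `[0, T]`, so this is a supremum of a bounded set. -/
def worstRegret {A Z : Type} [Fintype A] [Nonempty A] [MeasurableSpace A] [MeasurableSpace Z]
    {T : ℕ} (P : Environment A Z → Prop) (q : A → ProbabilityMeasure Z) (π : Policy A Z T) : ℝ :=
  ⨆ ν : {ν : Environment A Z // marginals ν = q ∧ P ν}, regret ν.1 π

/-- Adaptive minimax optimality with respect to `P`: up to a constant, for all `A`, `Z`, `q`, `T`,
the algorithm attains the minimax regret over all environments with marginals `q`, and also the
minimax regret over those of them with the property `P`. -/
def Algorithm.AdaptivelyMinimaxOptimal (𝔞 : Algorithm) (P : EnvironmentProperty) : Prop :=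
  ∃ C : ℝ, 0 < C ∧
    ∀ (A Z : Type) [Fintype A] [Nonempty A] [MeasurableSpace A] [DiscreteMeasurableSpace A]
      [Fintype Z] [MeasurableSpace Z] [DiscreteMeasurableSpace Z]
      (q : A → ProbabilityMeasure Z) (T : ℕ),
      worstRegret (fun _ => True) q (𝔞 A Z T q) ≤
          C * ⨅ π : Policy A Z T, worstRegret (fun _ => True) q π ∧
        worstRegret (P A Z) q (𝔞 A Z T q) ≤
          C * ⨅ π : Policy A Z T, worstRegret (P A Z) q π

end CausalBandit

end

open MeasureTheory ProbabilityTheory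

set_option linter.unusedSectionVars false

noncomputable section

namespace CausalBandit

/-! ### Histories, their independence of the current round, and the tower property -/

section History

variable {A Z : Type} [MeasurableSpace A] [MeasurableSpace Z] {T : ℕ}

/-! Use two contexts `z₀`, `z₁`. One arm `a₀` sees `z₁` with probability 1/2 + δ, every other arm
with probability 1/2. If the reward is 1 in `z₁` and Bernoulli(1/2) in `z₀` for all arms, the
environment is benign and `a₀` is best by δ/2. Raising the Bernoulli parameter of another arm `a` to
1/2 + 2δ keeps the marginals, hence the input of the algorithm, but makes `a` best by at least δ/2.
If the regret stays below δT/8 over all environments with these marginals, then `a` is played more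
than 3T/4 times on average in the perturbed environment. By a change of measure
(`Policy.pulls_change`) this forces order 1/δ² plays of `a` already in the benign one, up to a term
in 1/T. Summing over `a ≠ a₀` yields benign regret of order |A|/δ (`regret_hardEnv_ge`).

For (i), take δ of order √(|A|/T), so that the assumed worst-case bound lies below δT/8; then |A|/δ
is of order √(|A|T).

For (ii), fix δ = 1/8 and bound both minimax values from above. Explore-then-commit
(`exists_policy_regret_le`) makes the unrestricted value a small fraction of T. In benign
environments the arms other than `a₀` share one mean, and only the sign of a single number matters:
the difference of the mean rewards in `z₁` and `z₀`. Every play of any arm estimates it, so the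
benign value is at most 20√T, whatever |A| (`regret_followTheLeader_le`). An adaptive algorithm
would match both up to a constant, yet the first bound forces benign regret of order |A|. With |A| =
N⁴ and T of order N⁶ this is impossible for large N. -/

lemma Policy.history_congr (π : Policy A Z T) {ω ω' : Outcomes A Z T} :
    ∀ (t : ℕ) (ht : t ≤ T), (∀ s : Fin T, (s : ℕ) < t → ω s = ω' s) →
      π.history ω t ht = π.history ω' t ht
  | 0, _, _ => rfl
  | t + 1, ht, h => by
    have ih := π.history_congr t (Nat.le_of_succ_le ht) fun s hs => h s (by omega)
    have h' : ω ⟨t, ht⟩ = ω' ⟨t, ht⟩ := h _ (by simp)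
    simp only [Policy.history, ih, h']

lemma measurable_snoc {E : Type*} [MeasurableSpace E] {t : ℕ} :
    Measurable fun p : (Fin t → E) × E => (Fin.snoc (α := fun _ => E) p.1 p.2 : Fin (t + 1) → E) := by
  refine measurable_pi_iff.2 fun i => ?_
  refine Fin.lastCases ?_ (fun j => ?_) i
  · simpa using measurable_snd
  · simp only [Fin.snoc_castSucc]
    exact (measurable_pi_apply j).comp measurable_fst

variable [Fintype A] [DiscreteMeasurableSpace A]

/-- The next history, as a function of the past history and of the fresh potential outcomes. -/
def Policy.extend (π : Policy A Z T) (t : Fin T)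
    (p : (Fin (t : ℕ) → A × Z × Reward) × (A → Z × Reward)) :
    Fin ((t : ℕ) + 1) → A × Z × Reward :=
  Fin.snoc (α := fun _ => A × Z × Reward) p.1 (π.act t p.1, p.2 (π.act t p.1))

lemma measurable_eval_uncurry {E : Type*} [MeasurableSpace E] :
    Measurable fun p : (A → E) × A => p.1 p.2 :=
  measurable_from_prod_countable_left fun a => measurable_pi_apply a

lemma Policy.measurable_extend (π : Policy A Z T) (t : Fin T) : Measurable (π.extend t) := by
  refine measurable_snoc.comp (measurable_fst.prodMk ?_)
  have h := (π.measurable_act t).comp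
    (measurable_fst : Measurable fun p : (Fin (t : ℕ) → A × Z × Reward) × (A → Z × Reward) => p.1)
  exact h.prodMk (measurable_eval_uncurry.comp (measurable_snd.prodMk h))

lemma Policy.measurable_history (π : Policy A Z T) :
    ∀ (t : ℕ) (ht : t ≤ T), Measurable fun ω => π.history ω t ht
  | 0, _ => measurable_pi_iff.2 fun i => i.elim0
  | t + 1, ht =>
    (π.measurable_extend ⟨t, ht⟩).comp
      ((π.measurable_history t (Nat.le_of_succ_le ht)).prodMk (measurable_pi_apply _))

instance (ν : Environment A Z) : IsProbabilityMeasure (outcomeLaw ν T) := by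
  unfold outcomeLaw; infer_instance

/-- The past history is a function of the outcomes of earlier rounds only, and the rounds are
independent. -/
lemma Policy.map_history_prodMk (π : Policy A Z T) (ν : Environment A Z) (t : Fin T) :
    (outcomeLaw ν T).map (fun ω => (π.history ω t t.isLt.le, ω t)) =
      ((outcomeLaw ν T).map fun ω => π.history ω t t.isLt.le).prod
        (Measure.pi fun a => (ν a : Measure (Z × Reward))) := by
  have hind : iIndepFun (fun (s : Fin T) (ω : Outcomes A Z T) => ω s) (outcomeLaw ν T) :=
    iIndepFun_pi (X := fun _ => id) fun _ => measurable_id.aemeasurable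
  have h2 := hind.indepFun_finset (Finset.univ.filter fun s : Fin T => (s : ℕ) < t) {t}
    (by simp) (fun s => measurable_pi_apply s)
  obtain ⟨ω₀⟩ : Nonempty (Outcomes A Z T) := (outcomeLaw ν T).nonempty_of_neZero
  -- Rounds from `t` on are filled in from an arbitrary `ω₀`; by `Policy.history_congr` they do not
  -- affect the history.
  let Φ : ((Finset.univ.filter fun s : Fin T => (s : ℕ) < t) → A → Z × Reward) →
      (Fin (t : ℕ) → A × Z × Reward) := fun r =>
    π.history (fun s => if h : s ∈ Finset.univ.filter fun s : Fin T => (s : ℕ) < t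
      then r ⟨s, h⟩ else ω₀ s) t t.isLt.le
  have hΦ : Measurable Φ := by
    refine (π.measurable_history _ _).comp (measurable_pi_iff.2 fun s => ?_)
    split_ifs with h
    · exact measurable_pi_apply _
    · exact measurable_const
  have h3 := h2.comp hΦ (measurable_pi_apply (⟨t, by simp⟩ : ({t} : Finset (Fin T))))
  have h4 : IndepFun (fun ω : Outcomes A Z T => π.history ω t t.isLt.le) (fun ω => ω t)
      (outcomeLaw ν T) := by
    refine h3.congr (ae_of_all _ fun ω => ?_) (ae_of_all _ fun ω => rfl)
    refine π.history_congr _ _ fun s hs => ?_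
    simpa using fun h => absurd hs h.not_gt
  rw [(indepFun_iff_map_prod_eq_prod_map_map (π.measurable_history _ _).aemeasurable
    (measurable_pi_apply t).aemeasurable).1 h4]
  congr 1
  exact (measurePreserving_eval (fun _ : Fin T => Measure.pi fun a => (ν a : Measure (Z × Reward)))
    t).map_eq

/-- Bounded measurable real functions. -/
def BddMeasurable {E : Type*} [MeasurableSpace E] (g : E → ℝ) : Prop :=
  Measurable g ∧ ∃ M, ∀ x, |g x| ≤ M

namespace BddMeasurable

variable {E F : Type*} [MeasurableSpace E] [MeasurableSpace F] {f g : E → ℝ}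

lemma const (c : ℝ) : BddMeasurable fun _ : E => c := ⟨measurable_const, |c|, fun _ => le_rfl⟩

lemma comp (hg : BddMeasurable g) {u : F → E} (hu : Measurable u) :
    BddMeasurable fun x => g (u x) :=
  ⟨hg.1.comp hu, hg.2.imp fun _ h _ => h _⟩

lemma add (hf : BddMeasurable f) (hg : BddMeasurable g) : BddMeasurable fun x => f x + g x := by
  obtain ⟨M, hM⟩ := hf.2
  obtain ⟨N, hN⟩ := hg.2
  exact ⟨hf.1.add hg.1, M + N, fun x => (abs_add_le _ _).trans (add_le_add (hM x) (hN x))⟩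

lemma mul (hf : BddMeasurable f) (hg : BddMeasurable g) : BddMeasurable fun x => f x * g x := by
  obtain ⟨M, hM⟩ := hf.2
  obtain ⟨N, hN⟩ := hg.2
  refine ⟨hf.1.mul hg.1, M * N, fun x => ?_⟩
  rw [abs_mul]
  exact mul_le_mul (hM x) (hN x) (abs_nonneg _) ((abs_nonneg _).trans (hM x))

lemma neg (hf : BddMeasurable f) : BddMeasurable fun x => - f x := by
  simpa using (const (-1)).mul hf

lemma sub (hf : BddMeasurable f) (hg : BddMeasurable g) : BddMeasurable fun x => f x - g x := by
  simpa [sub_eq_add_neg] using hf.add hg.neg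

lemma pow (hf : BddMeasurable f) (n : ℕ) : BddMeasurable fun x => f x ^ n := by
  induction n with
  | zero => simpa using const 1
  | succ n ih => simpa [pow_succ] using ih.mul hf

lemma sum {ι : Type*} {s : Finset ι} {f : ι → E → ℝ} (hf : ∀ i ∈ s, BddMeasurable (f i)) :
    BddMeasurable fun x => ∑ i ∈ s, f i x := by
  classical
  induction s using Finset.induction_on with
  | empty => simpa using const 0
  | insert a s ha ih =>
    simp only [Finset.sum_insert ha]
    exact (hf a (by simp)).add (ih fun i hi => hf i (by simp [hi]))

lemma integrable (hf : BddMeasurable f) (μ : Measure E) [IsFiniteMeasure μ] : Integrable f μ :=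
  let ⟨M, hM⟩ := hf.2
  Integrable.of_bound hf.1.aestronglyMeasurable M (ae_of_all _ hM)

lemma integral_prod_right {f : E × F → ℝ} (hf : BddMeasurable f) (μ : Measure F)
    [IsProbabilityMeasure μ] : BddMeasurable fun x => ∫ y, f (x, y) ∂μ := by
  obtain ⟨M, hM⟩ := hf.2
  refine ⟨(hf.1.stronglyMeasurable.integral_prod_right').measurable, M, fun x => ?_⟩
  simpa using norm_integral_le_of_norm_le_const (μ := μ) (f := fun y => f (x, y))
    (ae_of_all _ fun y => hM (x, y))

end BddMeasurable

/-- Conditional expectation of a function of the next history, given the past history. -/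
def Policy.step (π : Policy A Z T) (ν : Environment A Z) (t : Fin T)
    (g : (Fin ((t : ℕ) + 1) → A × Z × Reward) → ℝ) (h : Fin (t : ℕ) → A × Z × Reward) : ℝ :=
  ∫ x, g (Fin.snoc (α := fun _ => A × Z × Reward) h (π.act t h, x)) ∂(ν (π.act t h) :
    Measure (Z × Reward))

lemma Policy.integral_extend (π : Policy A Z T) (ν : Environment A Z) (t : Fin T)
    {g : (Fin ((t : ℕ) + 1) → A × Z × Reward) → ℝ} (hg : Measurable g)
    (h : Fin (t : ℕ) → A × Z × Reward) :
    ∫ u, g (π.extend t (h, u)) ∂(Measure.pi fun a => (ν a : Measure (Z × Reward))) =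
      π.step ν t g h := by
  have := measurePreserving_eval (fun a => (ν a : Measure (Z × Reward))) (π.act t h)
  rw [Policy.step, ← this.map_eq, integral_map this.measurable.aemeasurable]
  · rfl
  · exact (hg.comp (measurable_snoc.comp (measurable_const.prodMk
      (measurable_const.prodMk measurable_id)))).aestronglyMeasurable

lemma BddMeasurable.step {π : Policy A Z T} (ν : Environment A Z) {t : Fin T}
    {g : (Fin ((t : ℕ) + 1) → A × Z × Reward) → ℝ} (hg : BddMeasurable g) :
    BddMeasurable (π.step ν t g) := by
  rw [← funext fun h => π.integral_extend ν t hg.1 h]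
  exact (hg.comp (π.measurable_extend t)).integral_prod_right _

/-- Expectation of a function of the history of the first `t` rounds. -/
def Policy.expect (π : Policy A Z T) (ν : Environment A Z) (t : ℕ) (ht : t ≤ T)
    (g : (Fin t → A × Z × Reward) → ℝ) : ℝ :=
  ∫ ω, g (π.history ω t ht) ∂(outcomeLaw ν T)

/-- The tower property. It turns later claims about expectations into inductions on the round, in
which only the law of the played arm enters. -/
lemma Policy.expect_succ (π : Policy A Z T) (ν : Environment A Z) (t : Fin T)
    {g : (Fin ((t : ℕ) + 1) → A × Z × Reward) → ℝ} (hg : BddMeasurable g) :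
    π.expect ν (t + 1) t.isLt g = π.expect ν t t.isLt.le (π.step ν t g) := by
  have hge := hg.comp (π.measurable_extend t)
  have hm : Measurable fun ω : Outcomes A Z T => (π.history ω t t.isLt.le, ω t) :=
    (π.measurable_history _ _).prodMk (measurable_pi_apply t)
  have : IsProbabilityMeasure ((outcomeLaw ν T).map fun ω => π.history ω t t.isLt.le) :=
    Measure.isProbabilityMeasure_map (π.measurable_history _ _).aemeasurable
  calc π.expect ν (t + 1) t.isLt g
      = ∫ p, g (π.extend t p) ∂((outcomeLaw ν T).map fun ω => (π.history ω t t.isLt.le, ω t)) := by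
        rw [integral_map hm.aemeasurable hge.1.aestronglyMeasurable]
        rfl
    _ = ∫ h, π.step ν t g h ∂((outcomeLaw ν T).map fun ω => π.history ω t t.isLt.le) := by
        rw [π.map_history_prodMk ν t, integral_prod _ (hge.integrable _)]
        simp only [π.integral_extend ν t hg.1]
    _ = _ := by
        rw [integral_map (π.measurable_history _ _).aemeasurable
          (hg.step ν).1.aestronglyMeasurable]
        rfl

lemma Policy.expect_zero (π : Policy A Z T) (ν : Environment A Z)
    (g : (Fin 0 → A × Z × Reward) → ℝ) :
    π.expect ν 0 (Nat.zero_le T) g = g Fin.elim0 := by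
  simp [Policy.expect, Policy.history]

section Expect

variable (π : Policy A Z T) (ν : Environment A Z) {t : ℕ} (ht : t ≤ T)
  {f g : (Fin t → A × Z × Reward) → ℝ}

lemma Policy.integrable_history (hg : BddMeasurable g) :
    Integrable (fun ω => g (π.history ω t ht)) (outcomeLaw ν T) :=
  (hg.comp (π.measurable_history t ht)).integrable _

lemma Policy.expect_add (hf : BddMeasurable f) (hg : BddMeasurable g) :
    π.expect ν t ht (fun h => f h + g h) = π.expect ν t ht f + π.expect ν t ht g :=
  integral_add (π.integrable_history ν ht hf) (π.integrable_history ν ht hg)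

lemma Policy.expect_sub (hf : BddMeasurable f) (hg : BddMeasurable g) :
    π.expect ν t ht (fun h => f h - g h) = π.expect ν t ht f - π.expect ν t ht g :=
  integral_sub (π.integrable_history ν ht hf) (π.integrable_history ν ht hg)

lemma Policy.expect_const_mul (c : ℝ) :
    π.expect ν t ht (fun h => c * g h) = c * π.expect ν t ht g :=
  integral_const_mul _ _

lemma Policy.expect_const (c : ℝ) : π.expect ν t ht (fun _ => c) = c := by
  simp [Policy.expect]

lemma Policy.expect_mono (hf : BddMeasurable f) (hg : BddMeasurable g) (h : ∀ x, f x ≤ g x) :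
    π.expect ν t ht f ≤ π.expect ν t ht g :=
  integral_mono (π.integrable_history ν ht hf) (π.integrable_history ν ht hg) fun _ => h _

lemma Policy.expect_sum {ι : Type*} (s : Finset ι) {f : ι → (Fin t → A × Z × Reward) → ℝ}
    (hf : ∀ i ∈ s, BddMeasurable (f i)) :
    π.expect ν t ht (fun h => ∑ i ∈ s, f i h) = ∑ i ∈ s, π.expect ν t ht (f i) :=
  integral_finsetSum s fun i hi => π.integrable_history ν ht (hf i hi)

end Expect

end History

/-! ### Regret decomposition and change of measure for one arm -/

section ChangeOfMeasure

variable {A Z : Type} [MeasurableSpace A] [MeasurableSpace Z] {T : ℕ}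
  [Fintype A] [DiscreteMeasurableSpace A]

lemma meanReward_nonneg (ν : Environment A Z) (a : A) : 0 ≤ meanReward ν a :=
  integral_nonneg fun x => x.2.2.1

lemma bddMeasurable_reward : BddMeasurable fun x : Z × Reward => (x.2 : ℝ) :=
  ⟨measurable_subtype_coe.comp measurable_snd, 1, fun x => by
    rw [abs_of_nonneg x.2.2.1]; exact x.2.2.2⟩

lemma meanReward_le_one (ν : Environment A Z) (a : A) : meanReward ν a ≤ 1 := by
  have := integral_mono (μ := (ν a : Measure (Z × Reward)))
    (bddMeasurable_reward.integrable _) (integrable_const (1 : ℝ)) fun x => x.2.2.2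
  simpa [meanReward] using this

lemma bddMeasurable_act (π : Policy A Z T) (t : Fin T) (f : A → ℝ) :
    BddMeasurable fun h => f (π.act t h) := by
  refine BddMeasurable.comp (g := f) ⟨measurable_of_finite f, ∑ a, |f a|, fun a => ?_⟩
    (π.measurable_act t)
  exact Finset.single_le_sum (f := fun a => |f a|) (fun _ _ => abs_nonneg _) (Finset.mem_univ a)

/-- The regret incurred when playing `a` once. -/
def gap [Nonempty A] (ν : Environment A Z) (a : A) : ℝ :=
  Finset.univ.sup' Finset.univ_nonempty (meanReward ν) - meanReward ν a

lemma gap_nonneg [Nonempty A] (ν : Environment A Z) (a : A) : 0 ≤ gap ν a :=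
  sub_nonneg.2 (Finset.le_sup' (meanReward ν) (Finset.mem_univ a))

lemma exists_gap_eq [Nonempty A] (ν : Environment A Z) :
    ∃ b, ∀ a, gap ν a = meanReward ν b - meanReward ν a := by
  obtain ⟨b, -, hb⟩ := Finset.exists_mem_eq_sup' Finset.univ_nonempty (meanReward ν)
  exact ⟨b, fun a => by rw [gap, hb]⟩

lemma gap_le_one [Nonempty A] (ν : Environment A Z) (a : A) : gap ν a ≤ 1 := by
  obtain ⟨b, hb⟩ := exists_gap_eq ν
  linarith [hb a, meanReward_le_one ν b, meanReward_nonneg ν a]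

lemma regret_eq_sum [Nonempty A] (ν : Environment A Z) (π : Policy A Z T) :
    regret ν π = ∑ t : Fin T, π.expect ν t t.isLt.le fun h => gap ν (π.act t h) := by
  have h : ∀ t : Fin T, (π.expect ν t t.isLt.le fun h => gap ν (π.act t h)) =
      Finset.univ.sup' Finset.univ_nonempty (meanReward ν) -
        ∫ ω, meanReward ν (π.action ω t) ∂(outcomeLaw ν T) := by
    intro t
    unfold gap
    rw [π.expect_sub ν t.isLt.le (BddMeasurable.const _) (bddMeasurable_act π t (meanReward ν)),
      π.expect_const]
    rfl
  simp only [h, Finset.sum_sub_distrib, Finset.sum_const, Finset.card_univ, Fintype.card_fin,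
    nsmul_eq_mul, regret]
  rw [integral_finsetSum]
  exact fun t _ => π.integrable_history ν t.isLt.le (bddMeasurable_act π t (meanReward ν))

lemma regret_nonneg [Nonempty A] (ν : Environment A Z) (π : Policy A Z T) : 0 ≤ regret ν π := by
  rw [regret_eq_sum]
  exact Finset.sum_nonneg fun t _ => integral_nonneg fun _ => gap_nonneg _ _

lemma Policy.expect_le_of_le (π : Policy A Z T) (ν : Environment A Z) {t : ℕ} (ht : t ≤ T)
    {g : (Fin t → A × Z × Reward) → ℝ} (hg : BddMeasurable g) {c : ℝ} (h : ∀ x, g x ≤ c) :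
    π.expect ν t ht g ≤ c :=
  (π.expect_mono ν ht hg (BddMeasurable.const c) h).trans_eq (π.expect_const ν ht c)

lemma regret_le [Nonempty A] (ν : Environment A Z) (π : Policy A Z T) : regret ν π ≤ T := by
  rw [regret_eq_sum]
  refine (Finset.sum_le_sum fun t _ => π.expect_le_of_le ν t.isLt.le
    (bddMeasurable_act π t (gap ν)) fun _ => gap_le_one ν _).trans ?_
  simp

/-- The sum of `φ` over the rounds of a history. -/
def rewardSum (φ : A × Z × Reward → ℝ) {t : ℕ} (h : Fin t → A × Z × Reward) : ℝ := ∑ i, φ (h i)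

lemma rewardSum_snoc (φ : A × Z × Reward → ℝ) {t : ℕ} (h : Fin t → A × Z × Reward)
    (x : A × Z × Reward) :
    rewardSum φ (Fin.snoc (α := fun _ => A × Z × Reward) h x) = rewardSum φ h + φ x := by
  simp [rewardSum, Fin.sum_univ_castSucc]

lemma BddMeasurable.rewardSum {φ : A × Z × Reward → ℝ} (hφ : BddMeasurable φ) (t : ℕ) :
    BddMeasurable (CausalBandit.rewardSum φ : (Fin t → A × Z × Reward) → ℝ) :=
  BddMeasurable.sum fun i _ => hφ.comp (measurable_pi_apply i)

lemma BddMeasurable.section {φ : A × Z × Reward → ℝ} (hφ : BddMeasurable φ) (a : A) :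
    BddMeasurable fun x => φ (a, x) :=
  hφ.comp (measurable_const.prodMk measurable_id)

lemma Policy.expect_rewardSum_succ (π : Policy A Z T) (ν : Environment A Z)
    {φ : A × Z × Reward → ℝ} (hφ : BddMeasurable φ) (t : Fin T) :
    π.expect ν (t + 1) t.isLt (rewardSum φ) = π.expect ν t t.isLt.le (rewardSum φ) +
      π.expect ν t t.isLt.le fun h => ∫ x, φ (π.act t h, x) ∂(ν (π.act t h) :
        Measure (Z × Reward)) := by
  rw [π.expect_succ ν t (hφ.rewardSum _), ← π.expect_add ν t.isLt.le (hφ.rewardSum _)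
    (bddMeasurable_act π t fun a => ∫ x, φ (a, x) ∂(ν a : Measure (Z × Reward)))]
  congr 1
  funext h
  simp only [Policy.step, rewardSum_snoc]
  rw [integral_add (integrable_const _) ((hφ.section _).integrable _)]
  simp

variable [DecidableEq A]

/-- The indicator of the action `a`. -/
def actInd (a : A) (x : A × Z × Reward) : ℝ := if x.1 = a then 1 else 0

lemma bddMeasurable_actInd (a : A) : BddMeasurable (actInd a : A × Z × Reward → ℝ) :=
  ⟨(measurable_of_finite fun b : A => if b = a then (1 : ℝ) else 0).comp measurable_fst, 1,
    fun x => by unfold actInd; split_ifs <;> simp⟩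

/-- The expected number of times that `π` plays `a`. -/
def Policy.pulls (π : Policy A Z T) (ν : Environment A Z) (a : A) : ℝ :=
  π.expect ν T le_rfl (rewardSum (actInd a))

lemma Policy.expect_actInd (π : Policy A Z T) (ν : Environment A Z) (a : A) :
    ∀ (t : ℕ) (ht : t ≤ T), π.expect ν t ht (rewardSum (actInd a)) =
      ∑ s : Fin t, π.expect ν s (s.isLt.le.trans ht) fun h =>
        if π.act ⟨s, s.isLt.trans_le ht⟩ h = a then 1 else 0
  | 0, _ => by simp [rewardSum, Policy.expect]
  | t + 1, ht => by
    rw [π.expect_rewardSum_succ ν (bddMeasurable_actInd a) ⟨t, ht⟩,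
      π.expect_actInd ν a t (Nat.le_of_succ_le ht), Fin.sum_univ_castSucc]
    congr 1
    refine congrArg (π.expect ν t (Nat.le_of_succ_le ht)) (funext fun h => ?_)
    have hF : ∀ b, ∫ x, actInd a (b, x) ∂(ν b : Measure (Z × Reward)) =
        if b = a then 1 else 0 := fun b => by by_cases hb : b = a <;> simp [actInd, hb]
    exact hF _

lemma Policy.pulls_eq_sum (π : Policy A Z T) (ν : Environment A Z) (a : A) :
    π.pulls ν a = ∑ t : Fin T, π.expect ν t t.isLt.le fun h => if π.act t h = a then 1 else 0 :=
  π.expect_actInd ν a T le_rfl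

lemma rewardSum_actInd_nonneg (a : A) {t : ℕ} (h : Fin t → A × Z × Reward) :
    0 ≤ rewardSum (actInd a) h :=
  Finset.sum_nonneg fun i _ => by unfold actInd; split_ifs <;> simp

lemma rewardSum_actInd_le (a : A) {t : ℕ} (h : Fin t → A × Z × Reward) :
    rewardSum (actInd a) h ≤ t := by
  refine (Finset.sum_le_sum (g := fun _ => (1 : ℝ)) fun i _ => ?_).trans (by simp)
  unfold actInd; split_ifs <;> simp

lemma Policy.pulls_nonneg (π : Policy A Z T) (ν : Environment A Z) (a : A) : 0 ≤ π.pulls ν a :=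
  integral_nonneg fun _ => rewardSum_actInd_nonneg _ _

lemma Policy.sum_pulls (π : Policy A Z T) (ν : Environment A Z) : ∑ a, π.pulls ν a = T := by
  unfold Policy.pulls
  rw [← π.expect_sum ν le_rfl _ fun a _ => (bddMeasurable_actInd a).rewardSum T]
  have : (fun h : Fin T → A × Z × Reward => ∑ a, rewardSum (actInd a) h) = fun _ => (T : ℝ) := by
    funext h
    simp only [rewardSum]
    rw [Finset.sum_comm]
    simp [actInd]
  rw [this, π.expect_const]

lemma regret_eq_sum_pulls [Nonempty A] (ν : Environment A Z) (π : Policy A Z T) :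
    regret ν π = ∑ a, gap ν a * π.pulls ν a := by
  simp only [regret_eq_sum, π.pulls_eq_sum, Finset.mul_sum]
  rw [Finset.sum_comm]
  refine Finset.sum_congr rfl fun t _ => ?_
  simp only [← π.expect_const_mul ν t.isLt.le]
  rw [← π.expect_sum ν t.isLt.le _ fun a _ => (BddMeasurable.const (gap ν a)).mul
    (bddMeasurable_act π t fun b => if b = a then 1 else 0)]
  simp

/-- The likelihood ratio of a history when the law of `a` is changed with density `L`. -/
def likelihood (a : A) (L : Z × Reward → ℝ) {t : ℕ} (h : Fin t → A × Z × Reward) : ℝ :=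
  ∏ i, if (h i).1 = a then L (h i).2 else 1

lemma likelihood_snoc (a : A) (L : Z × Reward → ℝ) {t : ℕ} (h : Fin t → A × Z × Reward)
    (x : A × Z × Reward) :
    likelihood a L (Fin.snoc (α := fun _ => A × Z × Reward) h x) =
      likelihood a L h * if x.1 = a then L x.2 else 1 := by
  simp [likelihood, Fin.prod_univ_castSucc]

lemma BddMeasurable.actIte (a : A) {f g : Z × Reward → ℝ} (hf : BddMeasurable f)
    (hg : BddMeasurable g) :
    BddMeasurable fun x : A × Z × Reward => if x.1 = a then f x.2 else g x.2 := by
  have h := ((bddMeasurable_actInd (Z := Z) a).mul (hf.comp measurable_snd)).add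
    (((BddMeasurable.const 1).sub (bddMeasurable_actInd (Z := Z) a)).mul (hg.comp measurable_snd))
  convert h using 2 with x
  unfold actInd
  split_ifs <;> simp

lemma BddMeasurable.likelihood (a : A) {L : Z × Reward → ℝ} (hL : BddMeasurable L) (t : ℕ) :
    BddMeasurable (likelihood a L : (Fin t → A × Z × Reward) → ℝ) := by
  have h := hL.actIte a (BddMeasurable.const 1)
  unfold CausalBandit.likelihood
  generalize (Finset.univ : Finset (Fin t)) = s
  induction s using Finset.induction_on with
  | empty => simpa using BddMeasurable.const 1
  | insert i s hi ih =>
    simp only [Finset.prod_insert hi]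
    exact (h.comp (measurable_pi_apply i)).mul ih

lemma BddMeasurable.comp_snoc {t : ℕ} {g : (Fin (t + 1) → A × Z × Reward) → ℝ}
    (hg : BddMeasurable g) (h : Fin t → A × Z × Reward) (a : A) :
    BddMeasurable fun x : Z × Reward => g (Fin.snoc (α := fun _ => A × Z × Reward) h (a, x)) :=
  hg.comp (measurable_snoc.comp (measurable_const.prodMk (measurable_const.prodMk measurable_id)))

variable {ν ν' : Environment A Z} {a : A} {L : Z × Reward → ℝ}

/-- Each play of `a` contributes one factor `L`; rounds with another arm have the same law in both
environments. -/
theorem Policy.expect_eq_expect_mul_likelihood (π : Policy A Z T) (hL : BddMeasurable L)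
    (hne : ∀ b, b ≠ a → ν' b = ν b)
    (hdens : ∀ f, BddMeasurable f → ∫ x, f x ∂(ν' a : Measure (Z × Reward)) =
      ∫ x, f x * L x ∂(ν a : Measure (Z × Reward))) :
    ∀ (t : ℕ) (ht : t ≤ T) {g : (Fin t → A × Z × Reward) → ℝ}, BddMeasurable g →
      π.expect ν' t ht g = π.expect ν t ht fun h => g h * likelihood a L h
  | 0, _, g, _ => by
    rw [π.expect_zero, π.expect_zero]
    simp [likelihood]
  | t + 1, ht, g, hg => by
    rw [π.expect_succ ν' ⟨t, ht⟩ hg, π.expect_succ ν ⟨t, ht⟩ (hg.mul (hL.likelihood a _)),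
      π.expect_eq_expect_mul_likelihood hL hne hdens t (Nat.le_of_succ_le ht) (hg.step ν')]
    congr 1
    funext h
    simp only [Policy.step, likelihood_snoc]
    by_cases hb : π.act ⟨t, ht⟩ h = a
    · simp only [hb, if_true]
      rw [hdens _ (hg.comp_snoc h a), ← integral_mul_const]
      exact integral_congr_ae (ae_of_all _ fun x => by ring)
    · simp only [hb, if_false, hne _ hb, mul_one]
      rw [← integral_mul_const]

/-- Divergence decomposition: only plays of `a` contribute, each with the same conditional mean
given the past. -/
lemma Policy.expect_log_likelihood (π : Policy A Z T) (hlog : BddMeasurable fun x => Real.log (L x)) :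
    ∀ (t : ℕ) (ht : t ≤ T),
      π.expect ν t ht (rewardSum fun x => if x.1 = a then Real.log (L x.2) else 0) =
        (∫ x, Real.log (L x) ∂(ν a : Measure (Z × Reward))) *
          π.expect ν t ht (rewardSum (actInd a))
  | 0, _ => by simp [rewardSum, Policy.expect]
  | t + 1, ht => by
    rw [π.expect_rewardSum_succ ν (bddMeasurable_actInd a) ⟨t, ht⟩,
      π.expect_rewardSum_succ ν (hlog.actIte a (BddMeasurable.const 0)) ⟨t, ht⟩,
      π.expect_log_likelihood hlog t (Nat.le_of_succ_le ht), mul_add]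
    congr 1
    rw [← π.expect_const_mul]
    congr 1
    funext h
    by_cases hb : π.act ⟨t, ht⟩ h = a <;> simp [hb, actInd]

lemma log_likelihood (hpos : ∀ x, 0 < L x) {t : ℕ} (h : Fin t → A × Z × Reward) :
    Real.log (likelihood a L h) = rewardSum (fun x => if x.1 = a then Real.log (L x.2) else 0) h := by
  rw [likelihood, rewardSum, Real.log_prod]
  · refine Finset.sum_congr rfl fun i _ => ?_
    split_ifs <;> simp
  · intro i _
    split_ifs
    · exact (hpos _).ne'
    · exact one_ne_zero

/-- Both sides are affine in `f`, so the cases `f = 0` and `f = 1` suffice. With `w` a likelihood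
ratio and `f` a statistic, this replaces an information inequality such as Pinsker's. -/
lemma mul_ge_log {w f : ℝ} (hw : 0 < w) (h0 : 0 ≤ f) (h1 : f ≤ 1) :
    1 + Real.log w - w / 4 - 4 * (1 - f) ≤ f * w := by
  have h2 : Real.log w ≤ w - 1 := Real.log_le_sub_one_of_pos hw
  have h3 : Real.log (w / 4) ≤ w / 4 - 1 := Real.log_le_sub_one_of_pos (by positivity)
  have h4 : Real.log (4 : ℝ) ≤ 4 - 1 := Real.log_le_sub_one_of_pos (by norm_num)
  rw [Real.log_div hw.ne' (by norm_num)] at h3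
  nlinarith

/-- An arm that is rarely played in `ν` is rarely played after a small change of its law. -/
theorem Policy.pulls_change (π : Policy A Z T) (hT : 0 < T) (hL : BddMeasurable L)
    (hpos : ∀ x, 0 < L x) (hlog : BddMeasurable fun x => Real.log (L x))
    (hne : ∀ b, b ≠ a → ν' b = ν b)
    (hdens : ∀ f, BddMeasurable f → ∫ x, f x ∂(ν' a : Measure (Z × Reward)) =
      ∫ x, f x * L x ∂(ν a : Measure (Z × Reward))) :
    3 / 4 + (∫ x, Real.log (L x) ∂(ν a : Measure (Z × Reward))) * π.pulls ν a
      - 4 / T * π.pulls ν a ≤ 1 - (T : ℝ)⁻¹ * π.pulls ν' a := by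
  have hT' : (0 : ℝ) < T := by exact_mod_cast hT
  have hN : BddMeasurable (rewardSum (actInd a) : (Fin T → A × Z × Reward) → ℝ) :=
    (bddMeasurable_actInd a).rewardSum T
  have hW := hL.likelihood a T
  have hlogW := (hlog.actIte a (BddMeasurable.const 0)).rewardSum T
  have hf : BddMeasurable fun h : Fin T → A × Z × Reward =>
      1 - (T : ℝ)⁻¹ * rewardSum (actInd a) h :=
    (BddMeasurable.const 1).sub ((BddMeasurable.const _).mul hN)
  have h1 : π.expect ν' T le_rfl (fun h => 1 - (T : ℝ)⁻¹ * rewardSum (actInd a) h) =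
      1 - (T : ℝ)⁻¹ * π.pulls ν' a := by
    rw [π.expect_sub ν' le_rfl (BddMeasurable.const 1) ((BddMeasurable.const _).mul hN),
      π.expect_const, π.expect_const_mul, Policy.pulls]
  have h2 : π.expect ν T le_rfl (likelihood a L) = 1 := by
    have := π.expect_eq_expect_mul_likelihood hL hne hdens T le_rfl (BddMeasurable.const 1)
    simpa [π.expect_const] using this.symm
  rw [← h1, π.expect_eq_expect_mul_likelihood hL hne hdens T le_rfl hf]
  -- Apply `mul_ge_log` with `f` the fraction of rounds not spent on `a`. The likelihood has mean 1,
  -- so `1 - w / 4` becomes 3/4.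
  refine le_trans (le_of_eq ?_) (π.expect_mono ν le_rfl
    (f := fun h => ((1 + rewardSum (fun x => if x.1 = a then Real.log (L x.2) else 0) h)
      - 1 / 4 * likelihood a L h) - 4 / T * rewardSum (actInd a) h)
    ((((BddMeasurable.const 1).add hlogW).sub ((BddMeasurable.const _).mul hW)).sub
      ((BddMeasurable.const _).mul hN)) (hf.mul hW) fun h => ?_)
  · rw [π.expect_sub ν le_rfl (((BddMeasurable.const 1).add hlogW).sub
      ((BddMeasurable.const _).mul hW)) ((BddMeasurable.const _).mul hN),
      π.expect_sub ν le_rfl ((BddMeasurable.const 1).add hlogW) ((BddMeasurable.const _).mul hW),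
      π.expect_add ν le_rfl (BddMeasurable.const 1) hlogW, π.expect_const, π.expect_const_mul,
      π.expect_const_mul, h2, π.expect_log_likelihood hlog, Policy.pulls]
    ring
  · rw [← log_likelihood hpos]
    have hw : 0 < likelihood a L h := Finset.prod_pos fun i _ => by
      split_ifs
      · exact hpos _
      · exact one_pos
    have := mul_ge_log (f := 1 - (T : ℝ)⁻¹ * rewardSum (actInd a) h) hw
      (by
        have := rewardSum_actInd_le a h
        rw [sub_nonneg, inv_mul_le_iff₀ hT']
        simpa using this)
      (by
        have := mul_nonneg (inv_nonneg.2 hT'.le) (rewardSum_actInd_nonneg a h)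
        linarith)
    refine le_trans (le_of_eq ?_) this
    ring

end ChangeOfMeasure

/-! ### Two-context environments with prescribed marginals -/

section Environments

/-- The law with mass `r` at `x` and `1 - r` at `y`. -/
def twoPoint {E : Type*} [MeasurableSpace E] (x y : E) (r : unitInterval) : ProbabilityMeasure E :=
  ⟨ENNReal.ofReal r • Measure.dirac x + ENNReal.ofReal (1 - r) • Measure.dirac y, ⟨by
    simp only [Measure.coe_add, Measure.coe_smul, Pi.add_apply, Pi.smul_apply, measure_univ,
      smul_eq_mul, mul_one]
    rw [← ENNReal.ofReal_add r.2.1 (sub_nonneg.2 r.2.2)]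
    simp⟩⟩

lemma integral_twoPoint {E : Type*} [MeasurableSpace E] [MeasurableSingletonClass E] (x y : E)
    (r : unitInterval) (f : E → ℝ) :
    ∫ e, f e ∂(twoPoint x y r : Measure E) = r * f x + (1 - r) * f y := by
  have h : ∀ z : E, Integrable f (Measure.dirac z) := fun z =>
    integrable_dirac (by simp)
  rw [twoPoint, ProbabilityMeasure.coe_mk, integral_add_measure
    ((h x).smul_measure ENNReal.ofReal_ne_top) ((h y).smul_measure ENNReal.ofReal_ne_top)]
  simp [integral_smul_measure, integral_dirac, ENNReal.toReal_ofReal r.2.1,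
    ENNReal.toReal_ofReal (sub_nonneg.2 r.2.2)]

lemma twoPoint_absolutelyContinuous {E : Type*} [MeasurableSpace E] (x y : E) {r s : unitInterval}
    (h0 : 0 < s) (h1 : s < 1) : (twoPoint x y r : Measure E) ≪ (twoPoint x y s : Measure E) := by
  have h0' : (0 : ℝ) < s := h0
  have h1' : (s : ℝ) < 1 := h1
  refine Measure.AbsolutelyContinuous.mk fun S _ hS => ?_
  simp only [twoPoint, ProbabilityMeasure.coe_mk, Measure.coe_add, Measure.coe_smul, Pi.add_apply,
    Pi.smul_apply, smul_eq_mul, add_eq_zero, mul_eq_zero, ENNReal.ofReal_eq_zero] at hS ⊢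
  exact ⟨Or.inr (hS.1.resolve_left (by linarith)), Or.inr (hS.2.resolve_left (by linarith))⟩

variable {A Z : Type} [MeasurableSpace A] [MeasurableSpace Z]

/-- The environment with marginals `q` and conditional laws `κ`. -/
def envOf (q : A → ProbabilityMeasure Z) (κ : A → Kernel Z Reward) [∀ a, IsMarkovKernel (κ a)] :
    Environment A Z := fun a => ⟨(q a : Measure Z) ⊗ₘ κ a, inferInstance⟩

lemma marginals_envOf (q : A → ProbabilityMeasure Z) (κ : A → Kernel Z Reward)
    [∀ a, IsMarkovKernel (κ a)] : marginals (envOf q κ) = q := by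
  funext a
  exact Subtype.ext (Measure.fst_compProd _ _)

lemma isCondLaw_compProd (q : ProbabilityMeasure Z) (κ : Kernel Z Reward) [IsMarkovKernel κ] :
    IsCondLaw ⟨(q : Measure Z) ⊗ₘ κ, inferInstance⟩ κ :=
  ⟨inferInstance, ⟨by rw [ProbabilityMeasure.coe_mk, Measure.fst_compProd]⟩⟩

/-- The shared kernel is itself a version of every conditional law; `p` only has to dominate the
marginals. -/
lemma conditionallyBenign_envOf {q : A → ProbabilityMeasure Z} {κ : Kernel Z Reward}
    [IsMarkovKernel κ] {p : ProbabilityMeasure Z} (h : ∀ a, (q a : Measure Z) ≪ p) :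
    ConditionallyBenign (envOf q fun _ => κ) := by
  refine ⟨⟨(p : Measure Z) ⊗ₘ κ, inferInstance⟩, κ, isCondLaw_compProd p κ, fun a =>
    ⟨?_, κ, isCondLaw_compProd (q a) κ, ae_of_all _ fun _ => rfl⟩⟩
  simpa [envOf, Measure.fst_compProd] using h a

variable [DiscreteMeasurableSpace Z] [Fintype Z] [DecidableEq Z]

/-- The reward is `1` in every context except `z₀`, where it is Bernoulli with parameter `s`. -/
def rewardKernel (z₀ : Z) (s : unitInterval) : Kernel Z Reward where
  toFun z := if z = z₀ then (twoPoint (1 : Reward) 0 s : Measure Reward) else Measure.dirac 1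
  measurable' := Measurable.of_discrete

instance (z₀ : Z) (s : unitInterval) : IsMarkovKernel (rewardKernel z₀ s) :=
  ⟨fun z => by
    change IsProbabilityMeasure (if z = z₀ then (twoPoint (1 : Reward) 0 s : Measure Reward)
      else Measure.dirac 1)
    split_ifs <;> infer_instance⟩

lemma integral_compProd_rewardKernel {z₀ z₁ : Z} (hz : z₀ ≠ z₁) (r s : unitInterval)
    {f : Z × Reward → ℝ} (hf : BddMeasurable f) :
    ∫ x, f x ∂((twoPoint z₁ z₀ r : Measure Z) ⊗ₘ rewardKernel z₀ s) =
      r * f (z₁, 1) + (1 - r) * (s * f (z₀, 1) + (1 - s) * f (z₀, 0)) := by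
  rw [Measure.integral_compProd (hf.integrable _), integral_twoPoint]
  congr 2
  · change ∫ y, f (z₁, y) ∂(if z₁ = z₀ then (twoPoint (1 : Reward) 0 s : Measure Reward)
      else Measure.dirac 1) = _
    rw [if_neg hz.symm, integral_dirac]
  · change ∫ y, f (z₀, y) ∂(if z₀ = z₀ then (twoPoint (1 : Reward) 0 s : Measure Reward)
      else Measure.dirac 1) = _
    rw [if_pos rfl, integral_twoPoint]

end Environments

/-! ### The lower bound for the benign environment -/

section LowerBound

variable {A Z : Type} [MeasurableSpace A] [MeasurableSpace Z] {T : ℕ}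
  [Fintype A] [DiscreteMeasurableSpace A] [DiscreteMeasurableSpace Z] [Fintype Z] [DecidableEq Z]
  [DecidableEq A]

/-- Context marginals under which `a₀` sees `z₁` slightly more often than the other actions. -/
def hardMarginals (z₀ z₁ : Z) (a₀ : A) (r : unitInterval) (a : A) : ProbabilityMeasure Z :=
  twoPoint z₁ z₀ (if a = a₀ then r else ⟨1 / 2, by norm_num, by norm_num⟩)

/-- The environment with marginals `hardMarginals` and parameters `s a` of the reward kernels. -/
def hardEnv (z₀ z₁ : Z) (a₀ : A) (r : unitInterval) (s : A → unitInterval) : Environment A Z :=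
  envOf (hardMarginals z₀ z₁ a₀ r) fun a => rewardKernel z₀ (s a)

lemma integral_hardEnv {z₀ z₁ : Z} (hz : z₀ ≠ z₁) (a₀ : A) (r : unitInterval)
    (s : A → unitInterval) (a : A) {f : Z × Reward → ℝ} (hf : BddMeasurable f) :
    ∫ x, f x ∂(hardEnv z₀ z₁ a₀ r s a : Measure (Z × Reward)) =
      (if a = a₀ then (r : ℝ) else 1 / 2) * f (z₁, 1) + (1 - if a = a₀ then (r : ℝ) else 1 / 2) *
        (s a * f (z₀, 1) + (1 - s a) * f (z₀, 0)) := by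
  rw [hardEnv, envOf, ProbabilityMeasure.coe_mk, hardMarginals,
    integral_compProd_rewardKernel hz _ _ hf]
  split_ifs <;> rfl

lemma meanReward_hardEnv {z₀ z₁ : Z} (hz : z₀ ≠ z₁) (a₀ : A) (r : unitInterval)
    (s : A → unitInterval) (a : A) :
    meanReward (hardEnv z₀ z₁ a₀ r s) a = (if a = a₀ then (r : ℝ) else 1 / 2) +
      (1 - if a = a₀ then (r : ℝ) else 1 / 2) * s a := by
  rw [meanReward, integral_hardEnv hz a₀ r s a bddMeasurable_reward]
  simp

/-- The density of the law of a perturbed action. -/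
def perturbation (z₀ : Z) (δ : ℝ) (x : Z × Reward) : ℝ :=
  if x.1 = z₀ then if x.2 = 1 then 1 + 4 * δ else 1 - 4 * δ else 1

lemma measurable_perturbation (z₀ : Z) (δ : ℝ) : Measurable (perturbation z₀ δ) :=
  Measurable.ite (measurable_fst (measurableSet_singleton z₀))
    (Measurable.ite (measurable_snd (measurableSet_singleton 1)) measurable_const measurable_const)
    measurable_const

lemma perturbation_mem (z₀ : Z) {δ : ℝ} (h0 : 0 ≤ δ) (h1 : δ ≤ 1 / 8) (x : Z × Reward) :
    perturbation z₀ δ x ∈ Set.Icc (1 / 2 : ℝ) 2 := by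
  unfold perturbation
  split_ifs <;> constructor <;> linarith

lemma bddMeasurable_perturbation (z₀ : Z) {δ : ℝ} (h0 : 0 ≤ δ) (h1 : δ ≤ 1 / 8) :
    BddMeasurable (perturbation z₀ δ) :=
  ⟨measurable_perturbation z₀ δ, 2, fun x => by
    obtain ⟨h, h'⟩ := perturbation_mem z₀ h0 h1 x
    rw [abs_of_nonneg (by linarith)]; exact h'⟩

lemma bddMeasurable_log_perturbation (z₀ : Z) {δ : ℝ} (h0 : 0 ≤ δ) (h1 : δ ≤ 1 / 8) :
    BddMeasurable fun x => Real.log (perturbation z₀ δ x) := by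
  refine ⟨Real.measurable_log.comp (measurable_perturbation z₀ δ), 1, fun x => ?_⟩
  obtain ⟨h, h'⟩ := perturbation_mem z₀ h0 h1 x
  have hp : 0 < perturbation z₀ δ x := by linarith
  have h2 : (perturbation z₀ δ x)⁻¹ ≤ 2 := by
    rw [inv_le_comm₀ hp two_pos]; linarith
  rw [abs_le]
  constructor
  · linarith [Real.one_sub_inv_le_log_of_pos hp]
  · linarith [Real.log_le_sub_one_of_pos hp]

/-- Apply `log y ≥ 1 - 1/y` to `y = (1 + x)(1 - x) = 1 - x²`. -/
lemma log_add_log_ge {x : ℝ} (h0 : 0 ≤ x) (h1 : x ≤ 1 / 2) :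
    - (4 * x ^ 2) ≤ Real.log (1 + x) + Real.log (1 - x) := by
  have hp : 0 < (1 + x) * (1 - x) := mul_pos (by linarith) (by linarith)
  rw [← Real.log_mul (by linarith) (by linarith)]
  refine le_trans ?_ (Real.one_sub_inv_le_log_of_pos hp)
  rw [le_sub_comm, inv_le_iff_one_le_mul₀ hp]
  nlinarith [sq_nonneg x, mul_nonneg (sq_nonneg x) (sub_nonneg.2 h1)]

/-- A policy whose regret is small in all environments with marginals `hardMarginals` explores in
the benign one. -/
theorem regret_hardEnv_ge [Nonempty A] (π : Policy A Z T) (hT : 0 < T) {z₀ z₁ : Z} (hz : z₀ ≠ z₁)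
    (a₀ : A) {δ V : ℝ} (h0 : 0 < δ) (h1 : δ ≤ 1 / 8) (r s : unitInterval) (hr : (r : ℝ) = 1 / 2 + δ)
    (hs : (s : ℝ) = 1 / 2)
    (hV : ∀ ν : Environment A Z, marginals ν = hardMarginals z₀ z₁ a₀ r → regret ν π ≤ V)
    (hlt : V < δ * T / 8) :
    δ * (Fintype.card A - 1) ≤ (64 * δ ^ 2 + 16 / T) *
      regret (hardEnv z₀ z₁ a₀ r fun _ => s) π := by
  have hT' : (0 : ℝ) < T := by exact_mod_cast hT
  set ν := hardEnv z₀ z₁ a₀ r fun _ => s with hν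
  have key : ∀ a, a ≠ a₀ → 1 / 2 ≤ (16 * δ ^ 2 + 4 / T) * π.pulls ν a := by
    intro a ha
    -- The mean of `a` becomes 3/4 + δ, against 3/4 + δ/2 for `a₀` and 3/4 for the rest, so every
    -- round without `a` costs at least δ/2.
    let s' : unitInterval := ⟨1 / 2 + 2 * δ, by linarith, by linarith⟩
    set ν' := hardEnv z₀ z₁ a₀ r (Function.update (fun _ => s) a s') with hν'
    have hreg : δ / 2 * (T - π.pulls ν' a) ≤ V := by
      refine le_trans ?_ (hV ν' (marginals_envOf _ _))
      rw [regret_eq_sum_pulls, ← π.sum_pulls ν', ← Finset.sum_erase_eq_sub (Finset.mem_univ a),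
        Finset.mul_sum]
      refine le_trans (Finset.sum_le_sum fun b hb => ?_) (Finset.sum_le_sum_of_subset_of_nonneg
        (Finset.subset_univ (Finset.univ.erase a))
        fun b _ _ => mul_nonneg (gap_nonneg _ _) (π.pulls_nonneg _ _))
      have hb' : b ≠ a := (Finset.mem_erase.1 hb).1
      refine mul_le_mul_of_nonneg_right ?_ (π.pulls_nonneg _ _)
      have h2 : meanReward ν' a - meanReward ν' b ≤ gap ν' b :=
        sub_le_sub_right (Finset.le_sup' _ (Finset.mem_univ a)) _
      refine le_trans ?_ h2
      rw [hν', meanReward_hardEnv hz, meanReward_hardEnv hz, if_neg ha, Function.update_self,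
        Function.update_of_ne hb', hs, hr]
      simp only [s']
      split_ifs <;> linarith
    -- Moving the parameter from 1/2 to 1/2 + 2δ multiplies the masses of the rewards 1 and 0 in
    -- `z₀` by 1 + 4δ and 1 - 4δ.
    have hch := π.pulls_change (ν := ν) (ν' := ν') (a := a) (L := perturbation z₀ δ) hT
      (bddMeasurable_perturbation z₀ h0.le h1)
      (fun x => by linarith [(perturbation_mem z₀ h0.le h1 x).1])
      (bddMeasurable_log_perturbation z₀ h0.le h1)
      (fun b hb => by
        apply Subtype.ext
        simp only [hν', hν, hardEnv, envOf, Function.update_of_ne hb])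
      (fun f hf => by
        rw [hν', hν, integral_hardEnv hz _ _ _ _ hf,
          integral_hardEnv hz _ _ _ _ (hf.mul (bddMeasurable_perturbation z₀ h0.le h1)),
          Function.update_self, hs]
        simp only [s', perturbation, if_neg hz.symm, if_neg ha, if_true,
          if_neg (zero_ne_one : (0 : Reward) ≠ 1)]
        ring)
    -- Both logarithms carry weight 1/2 · 1/2, and 4(4δ)²/4 = 16δ².
    have hint : -(16 * δ ^ 2) ≤
        ∫ x, Real.log (perturbation z₀ δ x) ∂(ν a : Measure (Z × Reward)) := by
      rw [hν, integral_hardEnv hz _ _ _ _ (bddMeasurable_log_perturbation z₀ h0.le h1), hs]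
      have := log_add_log_ge (x := 4 * δ) (by linarith) (by linarith)
      simp only [perturbation, if_neg hz.symm, if_neg ha]
      simp
      nlinarith [sq_nonneg δ]
    have h3 := mul_le_mul_of_nonneg_right hint (π.pulls_nonneg ν a)
    have h4 : 1 - (T : ℝ)⁻¹ * π.pulls ν' a ≤ 1 / 4 := by
      have : T - π.pulls ν' a ≤ T / 4 := by nlinarith
      calc 1 - (T : ℝ)⁻¹ * π.pulls ν' a = (T : ℝ)⁻¹ * (T - π.pulls ν' a) := by
            field_simp
        _ ≤ (T : ℝ)⁻¹ * (T / 4) := mul_le_mul_of_nonneg_left this (by positivity)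
        _ = 1 / 4 := by field_simp
    nlinarith
  have hR : δ / 2 * ∑ a ∈ Finset.univ.erase a₀, π.pulls ν a ≤ regret ν π := by
    rw [regret_eq_sum_pulls, Finset.mul_sum]
    refine le_trans (Finset.sum_le_sum fun b hb => ?_) (Finset.sum_le_sum_of_subset_of_nonneg
        (Finset.subset_univ (Finset.univ.erase a₀))
        fun b _ _ => mul_nonneg (gap_nonneg _ _) (π.pulls_nonneg _ _))
    refine mul_le_mul_of_nonneg_right ?_ (π.pulls_nonneg _ _)
    have h2 : meanReward ν a₀ - meanReward ν b ≤ gap ν b :=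
      sub_le_sub_right (Finset.le_sup' _ (Finset.mem_univ a₀)) _
    refine le_trans ?_ h2
    rw [hν, meanReward_hardEnv hz, meanReward_hardEnv hz, if_pos rfl,
      if_neg (Finset.mem_erase.1 hb).1, hs, hr]
    linarith
  have hsum : ((Fintype.card A : ℝ) - 1) * (1 / 2) ≤
      (16 * δ ^ 2 + 4 / T) * ∑ a ∈ Finset.univ.erase a₀, π.pulls ν a := by
    rw [Finset.mul_sum]
    refine le_trans (le_of_eq ?_) (Finset.sum_le_sum fun a ha => key a (Finset.mem_erase.1 ha).1)
    rw [Finset.sum_const, Finset.card_erase_of_mem (Finset.mem_univ _), Finset.card_univ,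
      nsmul_eq_mul, Nat.cast_sub Fintype.card_pos, Nat.cast_one]
  have hc : 0 ≤ 16 * δ ^ 2 + 4 / (T : ℝ) := by positivity
  have h5 := mul_le_mul_of_nonneg_left hR hc
  have h6 := mul_le_mul_of_nonneg_left hsum h0.le
  have h7 : (64 * δ ^ 2 + 16 / (T : ℝ)) = 4 * (16 * δ ^ 2 + 4 / T) := by ring
  rw [h7]
  nlinarith

lemma conditionallyBenign_hardEnv (z₀ z₁ : Z) (a₀ : A) (r s : unitInterval) :
    ConditionallyBenign (hardEnv z₀ z₁ a₀ r fun _ => s) := by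
  refine conditionallyBenign_envOf (p := twoPoint z₁ z₀ ⟨1 / 2, by norm_num, by norm_num⟩)
    fun a => twoPoint_absolutelyContinuous _ _ ?_ ?_
  · exact Subtype.mk_lt_mk.2 (by norm_num)
  · exact Subtype.mk_lt_mk.2 (by norm_num)

end LowerBound

/-! ### Second and fourth moments of martingale sums -/

section Moments

variable {A Z : Type} [MeasurableSpace A] [MeasurableSpace Z] {T : ℕ}
  [Fintype A] [DiscreteMeasurableSpace A]

/-- The sum of `ψ s` over the rounds `s` of a history. -/
def timedSum (ψ : ℕ → A × Z × Reward → ℝ) {t : ℕ} (h : Fin t → A × Z × Reward) : ℝ :=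
  ∑ i : Fin t, ψ i (h i)

lemma timedSum_snoc (ψ : ℕ → A × Z × Reward → ℝ) {t : ℕ} (h : Fin t → A × Z × Reward)
    (x : A × Z × Reward) :
    timedSum ψ (Fin.snoc (α := fun _ => A × Z × Reward) h x) = timedSum ψ h + ψ t x := by
  simp [timedSum, Fin.sum_univ_castSucc]

lemma BddMeasurable.timedSum {ψ : ℕ → A × Z × Reward → ℝ} (hψ : ∀ s, BddMeasurable (ψ s)) (t : ℕ) :
    BddMeasurable (CausalBandit.timedSum ψ : (Fin t → A × Z × Reward) → ℝ) :=
  BddMeasurable.sum fun i _ => (hψ i).comp (measurable_pi_apply i)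

lemma integral_add_sq_le {E : Type*} [MeasurableSpace E] (μ : Measure E) [IsProbabilityMeasure μ]
    {f : E → ℝ} (hf : BddMeasurable f) (h0 : ∫ x, f x ∂μ = 0) {v : ℝ} (hv : ∀ x, f x ^ 2 ≤ v)
    (D : ℝ) : ∫ x, (D + f x) ^ 2 ∂μ ≤ D ^ 2 + v := by
  have h : ∫ x, (D + f x) ^ 2 ∂μ ≤ ∫ x, ((D ^ 2 + v) + 2 * D * f x) ∂μ :=
    integral_mono ((((BddMeasurable.const D).add hf).pow 2).integrable μ)
      (((BddMeasurable.const _).add ((BddMeasurable.const (2 * D)).mul hf)).integrable μ)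
      fun x => by simp only; nlinarith [hv x]
  rwa [integral_add (integrable_const _) (((BddMeasurable.const (2 * D)).mul hf).integrable μ),
    integral_const_mul, h0, integral_const, probReal_univ, one_smul, mul_zero, add_zero] at h

/-- The linear term integrates to 0, and `f²(D - f)² ≥ 0` absorbs `4Df³` into `2D²f² + 2f⁴`. -/
lemma integral_add_pow_four_le {E : Type*} [MeasurableSpace E] (μ : Measure E)
    [IsProbabilityMeasure μ] {f : E → ℝ} (hf : BddMeasurable f) (h0 : ∫ x, f x ∂μ = 0) {v : ℝ}
    (hv : ∀ x, f x ^ 2 ≤ v) (D : ℝ) :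
    ∫ x, (D + f x) ^ 4 ∂μ ≤ D ^ 4 + 8 * v * D ^ 2 + 3 * v ^ 2 := by
  have h : ∫ x, (D + f x) ^ 4 ∂μ ≤
      ∫ x, ((D ^ 4 + 8 * v * D ^ 2 + 3 * v ^ 2) + 4 * D ^ 3 * f x) ∂μ := by
    refine integral_mono ((((BddMeasurable.const D).add hf).pow 4).integrable μ)
      (((BddMeasurable.const _).add ((BddMeasurable.const (4 * D ^ 3)).mul hf)).integrable μ)
      fun x => ?_
    have h1 : f x ^ 2 * D ^ 2 ≤ v * D ^ 2 := mul_le_mul_of_nonneg_right (hv x) (sq_nonneg D)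
    have h2 : (f x ^ 2) ^ 2 ≤ v ^ 2 := pow_le_pow_left₀ (sq_nonneg _) (hv x) 2
    have h3 : 0 ≤ f x ^ 2 * (D - f x) ^ 2 := by positivity
    simp only
    nlinarith
  rwa [integral_add (integrable_const _) (((BddMeasurable.const (4 * D ^ 3)).mul hf).integrable μ),
    integral_const_mul, h0, integral_const, probReal_univ, one_smul, mul_zero, add_zero] at h

/-- Martingale increments are orthogonal. Centring is required before round `n` only:
explore-then-commit leaves the schedule afterwards. -/
lemma Policy.expect_timedSum_sq_le (π : Policy A Z T) (ν : Environment A Z)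
    {ψ : ℕ → A × Z × Reward → ℝ} {v : ℕ → ℝ} {n : ℕ} (hψ : ∀ s, BddMeasurable (ψ s))
    (hv : ∀ s x, ψ s x ^ 2 ≤ v s)
    (hmean : ∀ (t : Fin T) (h), (t : ℕ) < n →
      ∫ x, ψ t (π.act t h, x) ∂(ν (π.act t h) : Measure (Z × Reward)) = 0) :
    ∀ (t : ℕ) (ht : t ≤ T), t ≤ n →
      π.expect ν t ht (fun h => timedSum ψ h ^ 2) ≤ ∑ s ∈ Finset.range t, v s
  | 0, _, _ => by simp [timedSum, Policy.expect]
  | t + 1, ht, htn => by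
    have hb := (BddMeasurable.timedSum hψ t).pow 2
    rw [π.expect_succ ν ⟨t, ht⟩ ((BddMeasurable.timedSum hψ (t + 1)).pow 2),
      Finset.sum_range_succ]
    refine (π.expect_mono ν _ (((BddMeasurable.timedSum hψ (t + 1)).pow 2).step (t := ⟨t, ht⟩) ν)
      (hb.add (BddMeasurable.const (v t))) fun h => ?_).trans ?_
    · simp only [Policy.step, timedSum_snoc]
      exact integral_add_sq_le _ ((hψ t).section _) (hmean ⟨t, ht⟩ h htn) (fun x => hv t _) _
    · rw [π.expect_add ν _ hb (BddMeasurable.const _), π.expect_const]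
      exact add_le_add_left (π.expect_timedSum_sq_le ν hψ hv hmean t _ (by omega)) _

/-- With `S` the sum of the earlier `v s`, the induction closes by `4S² + 8vS + 3v² ≤ 4(S + v)²`. -/
lemma Policy.expect_timedSum_pow_four_le (π : Policy A Z T) (ν : Environment A Z)
    {ψ : ℕ → A × Z × Reward → ℝ} {v : ℕ → ℝ} {n : ℕ} (hψ : ∀ s, BddMeasurable (ψ s))
    (hv : ∀ s x, ψ s x ^ 2 ≤ v s)
    (hmean : ∀ (t : Fin T) (h), (t : ℕ) < n →
      ∫ x, ψ t (π.act t h, x) ∂(ν (π.act t h) : Measure (Z × Reward)) = 0) :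
    ∀ (t : ℕ) (ht : t ≤ T), t ≤ n →
      π.expect ν t ht (fun h => timedSum ψ h ^ 4) ≤ 4 * (∑ s ∈ Finset.range t, v s) ^ 2
  | 0, _, _ => by simp [timedSum, Policy.expect]
  | t + 1, ht, htn => by
    have hb2 := (BddMeasurable.timedSum hψ t).pow 2
    have hb4 := (BddMeasurable.timedSum hψ t).pow 4
    have hB := (BddMeasurable.timedSum hψ (t + 1)).pow 4
    have hb := hb4.add ((BddMeasurable.const (8 * v t)).mul hb2)
    have hv0 : 0 ≤ v t := by
      obtain ⟨ω⟩ : Nonempty (Outcomes A Z T) := (outcomeLaw ν T).nonempty_of_neZero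
      exact (sq_nonneg _).trans (hv t (π.history ω (t + 1) ht (Fin.last t)))
    rw [π.expect_succ ν ⟨t, ht⟩ hB, Finset.sum_range_succ]
    refine (π.expect_mono ν _ (hB.step (t := ⟨t, ht⟩) ν)
      (hb.add (BddMeasurable.const (3 * v t ^ 2))) fun h => ?_).trans ?_
    · simp only [Policy.step, timedSum_snoc]
      exact integral_add_pow_four_le _ ((hψ t).section _) (hmean ⟨t, ht⟩ h htn) (fun x => hv t _) _
    · rw [π.expect_add ν _ hb (BddMeasurable.const _), π.expect_const,
        π.expect_add ν _ hb4 ((BddMeasurable.const _).mul hb2), π.expect_const_mul]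
      have h4 := π.expect_timedSum_pow_four_le ν hψ hv hmean t (Nat.le_of_succ_le ht) (by omega)
      have h2 := mul_le_mul_of_nonneg_left (π.expect_timedSum_sq_le ν hψ hv hmean t
        (Nat.le_of_succ_le ht) (by omega)) (by positivity : 0 ≤ 8 * v t)
      nlinarith [sq_nonneg (v t)]

end Moments

/-! ### Upper bound without the benign property -/

section ExploreThenCommit

variable {A Z : Type} [MeasurableSpace A] [MeasurableSpace Z] {T : ℕ}
  [Fintype A] [DiscreteMeasurableSpace A]

/-- Adding one arm at a time builds the argmax from finitely many measurable comparisons. -/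
lemma exists_measurable_argmax [Nonempty A] :
    ∃ g : (A → ℝ) → A, Measurable g ∧ ∀ (f : A → ℝ) (b : A), f b ≤ f (g f) := by
  classical
  have key : ∀ s : Finset A, s.Nonempty → ∃ g : (A → ℝ) → A, Measurable g ∧
      ∀ f : A → ℝ, ∀ b ∈ s, f b ≤ f (g f) := by
    intro s hs
    induction hs using Finset.Nonempty.cons_induction with
    | singleton a => exact ⟨fun _ => a, measurable_const, fun f b hb => by simp_all⟩
    | cons a s ha hs ih =>
      obtain ⟨g, hg, hmax⟩ := ih
      refine ⟨fun f => if f (g f) ≤ f a then a else g f, Measurable.ite ?_ measurable_const hg,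
        fun f b hb => ?_⟩
      · refine measurableSet_le ?_ (measurable_pi_apply a)
        exact measurable_eval_uncurry.comp (measurable_id.prodMk hg)
      · beta_reduce
        rcases Finset.mem_cons.1 hb with rfl | hb
        · split_ifs with h
          · exact le_rfl
          · exact (not_le.1 h).le
        · split_ifs with h
          · exact (hmax f b hb).trans h
          · exact hmax f b hb
  obtain ⟨g, hg, h⟩ := key Finset.univ Finset.univ_nonempty
  exact ⟨g, hg, fun f b => h f b (Finset.mem_univ b)⟩

lemma Policy.history_castLE (π : Policy A Z T) (ω : Outcomes A Z T) {n : ℕ} :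
    ∀ (t : ℕ) (ht : t ≤ T) (hn : n ≤ t) (i : Fin n),
      π.history ω t ht (Fin.castLE hn i) = π.history ω n (hn.trans ht) i := by
  intro t
  induction t with
  | zero => intro ht hn i; exact absurd i.isLt (by omega)
  | succ t ih =>
    intro ht hn i
    rcases hn.lt_or_eq with h | rfl
    · have h' : n ≤ t := by omega
      rw [← ih (Nat.le_of_succ_le ht) h' i]
      have : Fin.castLE hn i = (Fin.castLE h' i).castSucc := rfl
      rw [this]
      simp only [Policy.history, Fin.snoc_castSucc]
    · rfl

/-- Follow the schedule `σ` for `n` rounds, then commit to the action `best` of the history. -/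
def etc (T n : ℕ) (σ : ℕ → A) (best : (Fin n → A × Z × Reward) → A) (hbest : Measurable best) :
    Policy A Z T where
  act t h := if hn : n ≤ t then best fun i => h (Fin.castLE hn i) else σ t
  measurable_act t := by
    split_ifs with hn
    · exact hbest.comp (measurable_pi_iff.2 fun i => measurable_pi_apply _)
    · exact measurable_const

variable [DecidableEq A]

/-- The centred reward of round `s` if the schedule `σ` plays `a` in this round, `0` otherwise. -/
def centred (σ : ℕ → A) (a : A) (μ : ℝ) (s : ℕ) (x : A × Z × Reward) : ℝ :=
  if σ s = a then (x.2.2 : ℝ) - μ else 0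

lemma bddMeasurable_centred (σ : ℕ → A) (a : A) (μ : ℝ) (s : ℕ) :
    BddMeasurable (centred σ a μ s : A × Z × Reward → ℝ) := by
  unfold centred
  split_ifs
  · exact (bddMeasurable_reward.comp measurable_snd).sub (BddMeasurable.const μ)
  · exact BddMeasurable.const 0

lemma abs_le_add_pow_four_div {x η : ℝ} (hη : 0 < η) : |x| ≤ η + x ^ 4 / η ^ 3 := by
  rcases le_total |x| η with h | h
  · have : 0 ≤ x ^ 4 / η ^ 3 := by positivity
    linarith
  · have : |x| ≤ x ^ 4 / η ^ 3 := by
      rw [le_div_iff₀ (by positivity), ← Even.pow_abs (by decide : Even 4)]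
      calc |x| * η ^ 3 ≤ |x| * |x| ^ 3 :=
            mul_le_mul_of_nonneg_left (pow_le_pow_left₀ hη.le h 3) (abs_nonneg _)
        _ = |x| ^ 4 := by ring
    linarith

/-- After `m` plays of each arm, every deviation `D a` of a reward sum has fourth moment at most
`4m²`. The bound `|x| ≤ η + x⁴/η³`, with `D a ^ 4` replaced by the sum over all arms, controls all
deviations at once; this polynomial union bound is enough for (ii). -/
theorem exists_policy_regret_le [Nonempty A] {n m : ℕ} (hn : n ≤ T) (hm : 0 < m) (σ : ℕ → A)
    (hσ : ∀ a, ∑ s ∈ Finset.range n, (if σ s = a then (1 : ℝ) else 0) = m) {η : ℝ} (hη : 0 < η) :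
    ∃ π : Policy A Z T, ∀ ν : Environment A Z,
      regret ν π ≤ n + T * ((2 * η + 8 * Fintype.card A * (m : ℝ) ^ 2 / η ^ 3) / m) := by
  obtain ⟨g, hg, hmax⟩ := exists_measurable_argmax (A := A)
  have hm' : (0 : ℝ) < m := by exact_mod_cast hm
  let best : (Fin n → A × Z × Reward) → A := fun h => g fun a => timedSum (centred σ a 0) h
  have hbest : Measurable best := hg.comp (measurable_pi_iff.2 fun a =>
    (BddMeasurable.timedSum (bddMeasurable_centred σ a 0) n).1)
  let π := etc T n σ best hbest
  have hact : ∀ (t : Fin T) h, (t : ℕ) < n → π.act t h = σ t := fun t h ht => by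
    simp only [π, etc, dif_neg (not_le.2 ht)]
  refine ⟨π, fun ν => ?_⟩
  let D : A → (Fin n → A × Z × Reward) → ℝ := fun a => timedSum (centred σ a (meanReward ν a))
  have hD : ∀ a, BddMeasurable (D a) := fun a => BddMeasurable.timedSum (bddMeasurable_centred _ _ _) n
  have hD4 : ∀ a, π.expect ν n hn (fun h => D a h ^ 4) ≤ 4 * (m : ℝ) ^ 2 := by
    intro a
    rw [← hσ a]
    refine π.expect_timedSum_pow_four_le ν (n := n) (bddMeasurable_centred _ _ _)
      (v := fun s => if σ s = a then (1 : ℝ) else 0) (fun s x => ?_) (fun t h ht => ?_) n hn le_rfl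
    · unfold centred
      split_ifs
      · have h1 : (0 : ℝ) ≤ x.2.2 := x.2.2.2.1
        have h2 : (x.2.2 : ℝ) ≤ 1 := x.2.2.2.2
        have h3 := meanReward_nonneg ν a
        have h4 := meanReward_le_one ν a
        rw [sq_le_one_iff_abs_le_one, abs_le]
        constructor <;> linarith
      · simp
    · rw [hact t h ht]
      by_cases hs : σ t = a
      · subst hs
        simp only [centred, if_true]
        rw [integral_sub (bddMeasurable_reward.integrable _) (integrable_const _)]
        simp [meanReward]
      · simp [centred, hs]
  -- The policy does not know the means and compares uncentred sums; as all arms have `m` plays,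
  -- these rank `D a + m * meanReward ν a`.
  have hDeq : ∀ a h, timedSum (centred σ a 0) h = D a h + m * meanReward ν a := by
    intro a h
    simp only [D, timedSum]
    rw [← hσ a, Finset.sum_mul, Finset.sum_range, ← Finset.sum_add_distrib]
    refine Finset.sum_congr rfl fun i _ => ?_
    unfold centred
    split_ifs <;> ring
  have hgap : ∀ h, gap ν (best h) ≤ (2 * η + 2 / η ^ 3 * ∑ a, D a h ^ 4) / m := by
    intro h
    obtain ⟨b, hb⟩ := exists_gap_eq ν
    have habs : ∀ a, |D a h| ≤ η + 1 / η ^ 3 * ∑ a, D a h ^ 4 := fun a => by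
      refine (abs_le_add_pow_four_div hη).trans (add_le_add_right ?_ _)
      rw [div_eq_inv_mul, one_div]
      exact mul_le_mul_of_nonneg_left (Finset.single_le_sum (f := fun a => D a h ^ 4)
        (fun _ _ => by positivity) (Finset.mem_univ a)) (by positivity)
    have h1 := hmax (fun a => timedSum (centred σ a 0) h) b
    simp only [hDeq] at h1
    have h1' : D b h + m * meanReward ν b ≤ D (best h) h + m * meanReward ν (best h) := by
      simpa only [best, hDeq] using h1
    have h2 := habs b
    have h3 := habs (best h)
    have h4 := neg_abs_le (D b h)
    have h5 := le_abs_self (D (best h) h)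
    rw [hb, le_div_iff₀ hm']
    have h6 : 2 / η ^ 3 * ∑ a, D a h ^ 4 = 2 * (1 / η ^ 3 * ∑ a, D a h ^ 4) := by ring
    rw [h6]
    nlinarith
  have hexp : ∀ t : Fin T, n ≤ t → (π.expect ν t t.isLt.le fun h => gap ν (π.act t h)) ≤
      (2 * η + 8 * Fintype.card A * (m : ℝ) ^ 2 / η ^ 3) / m := by
    intro t ht
    have h1 : (π.expect ν t t.isLt.le fun h => gap ν (π.act t h)) =
        π.expect ν n hn fun h => gap ν (best h) := by
      unfold Policy.expect
      refine integral_congr_ae (ae_of_all _ fun ω => ?_)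
      simp only [π, etc, dif_pos ht]
      congr 2
      funext i
      exact Policy.history_castLE _ ω t t.isLt.le ht i
    have hS : BddMeasurable fun h => ∑ a, D a h ^ 4 := BddMeasurable.sum fun a _ => (hD a).pow 4
    have hB := (BddMeasurable.const (2 * η)).add ((BddMeasurable.const (2 / η ^ 3)).mul hS)
    have hgb : BddMeasurable fun h => gap ν (best h) :=
      ⟨(measurable_of_finite (gap ν)).comp hbest, 1, fun h => by
        rw [abs_of_nonneg (gap_nonneg _ _)]; exact gap_le_one _ _⟩
    rw [h1]
    refine (π.expect_mono ν hn hgb (g := fun h => (m : ℝ)⁻¹ * (2 * η + 2 / η ^ 3 * ∑ a, D a h ^ 4))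
      ((BddMeasurable.const _).mul hB) fun h => ?_).trans ?_
    · rw [← div_eq_inv_mul]; exact hgap h
    · rw [π.expect_const_mul, π.expect_add ν hn (BddMeasurable.const _)
        ((BddMeasurable.const _).mul hS), π.expect_const, π.expect_const_mul,
        π.expect_sum ν hn _ fun a _ => (hD a).pow 4, div_eq_inv_mul _ (m : ℝ)]
      refine mul_le_mul_of_nonneg_left (add_le_add_right ?_ _) (by positivity)
      calc 2 / η ^ 3 * ∑ a, π.expect ν n hn (fun h => D a h ^ 4)
          ≤ 2 / η ^ 3 * ∑ _a : A, 4 * (m : ℝ) ^ 2 :=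
            mul_le_mul_of_nonneg_left (Finset.sum_le_sum fun a _ => hD4 a) (by positivity)
        _ = 8 * Fintype.card A * (m : ℝ) ^ 2 / η ^ 3 := by
            rw [Finset.sum_const, Finset.card_univ, nsmul_eq_mul]; ring
  rw [regret_eq_sum]
  have hK : 0 ≤ (2 * η + 8 * Fintype.card A * (m : ℝ) ^ 2 / η ^ 3) / m := by positivity
  calc ∑ t : Fin T, π.expect ν t t.isLt.le (fun h => gap ν (π.act t h))
      ≤ ∑ t : Fin T, ((if (t : ℕ) < n then (1 : ℝ) else 0) +
          (2 * η + 8 * Fintype.card A * (m : ℝ) ^ 2 / η ^ 3) / m) := by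
        refine Finset.sum_le_sum fun t _ => ?_
        split_ifs with ht
        · have := π.expect_le_of_le ν t.isLt.le (bddMeasurable_act π t (gap ν))
            fun _ => gap_le_one ν _
          linarith
        · rw [zero_add]; exact hexp t (not_lt.1 ht)
    _ ≤ _ := by
        rw [Finset.sum_add_distrib, Finset.sum_const, Finset.card_univ, Fintype.card_fin,
          nsmul_eq_mul]
        refine add_le_add_left ?_ _
        rw [Finset.sum_boole, Nat.cast_le]
        calc (Finset.univ.filter fun t : Fin T => (t : ℕ) < n).card
            ≤ (Finset.range n).card := Finset.card_le_card_of_injOn (fun t => (t : ℕ))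
              (fun t ht => by simpa using ht) (fun _ _ _ _ h => Fin.ext h)
          _ = n := Finset.card_range n

lemma sum_range_mul_ofNat (n m : ℕ) [NeZero n] (a : Fin n) :
    ∑ s ∈ Finset.range (n * m), (if Fin.ofNat n s = a then (1 : ℝ) else 0) = m := by
  induction m with
  | zero => simp
  | succ m ih =>
    rw [Nat.mul_succ, Finset.sum_range_add, ih, Finset.sum_range]
    have : ∀ i : Fin n, Fin.ofNat n (n * m + i) = i := fun i => by
      ext; simp [Fin.ofNat, Nat.mod_eq_of_lt i.isLt]
    simp only [this, Finset.sum_ite_eq', Finset.mem_univ, if_true, Nat.cast_succ]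

end ExploreThenCommit

/-! ### Upper bound for benign environments, independent of the number of arms -/

section FollowTheLeader

variable {A Z : Type} [MeasurableSpace A] [MeasurableSpace Z] {T : ℕ}
  [Fintype A] [DiscreteMeasurableSpace A] [DiscreteMeasurableSpace Z] [Fintype Z] [DecidableEq Z]
  [DecidableEq A]

/-- In a conditionally benign environment with marginals `hardMarginals`, the laws of all actions
are mixtures of the same two laws. -/
lemma ConditionallyBenign.integral_eq {ν : Environment A Z} (h : ConditionallyBenign ν) {z₀ z₁ : Z}
    {a₀ : A} {r : unitInterval} (hq : marginals ν = hardMarginals z₀ z₁ a₀ r) :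
    ∃ κ : Kernel Z Reward, IsMarkovKernel κ ∧ ∀ a f, BddMeasurable f →
      ∫ x, f x ∂(ν a : Measure (Z × Reward)) =
        (if a = a₀ then (r : ℝ) else 1 / 2) * ∫ y, f (z₁, y) ∂κ z₁ +
          (1 - if a = a₀ then (r : ℝ) else 1 / 2) * ∫ y, f (z₀, y) ∂κ z₀ := by
  obtain ⟨p, κ, ⟨hκ, -⟩, h⟩ := h
  refine ⟨κ, hκ, fun a f hf => ?_⟩
  obtain ⟨hac, κa, ⟨hκa, hdis⟩, heq⟩ := h a
  have hfst : (ν a : Measure (Z × Reward)).fst = (hardMarginals z₀ z₁ a₀ r a : Measure Z) :=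
    congrArg (fun q : A → ProbabilityMeasure Z => (q a : Measure Z)) hq
  -- Absolute continuity carries the `p`-almost sure equality over to the marginal of the arm.
  have hae : ∀ᵐ z ∂(ν a : Measure (Z × Reward)).fst, κa z = κ z := hac.ae_le heq
  rw [hfst] at hae
  have hd := hdis.disintegrate
  rw [hfst] at hd
  rw [← hd, Measure.integral_compProd (hf.integrable _),
    integral_congr_ae (g := fun z => ∫ y, f (z, y) ∂κ z) (hae.mono fun z hz => by
      beta_reduce; rw [hz]), hardMarginals, integral_twoPoint]
  split_ifs <;> rfl

/-- An unbiased estimate of the difference between the mean rewards in the contexts `z₁` and `z₀`,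
from one round. -/
def contrast (z₀ z₁ : Z) (a₀ : A) (r : ℝ) (x : A × Z × Reward) : ℝ :=
  x.2.2 * ((if x.2.1 = z₁ then (if x.1 = a₀ then r else 1 / 2)⁻¹ else 0) -
    if x.2.1 = z₀ then (1 - if x.1 = a₀ then r else 1 / 2)⁻¹ else 0)

lemma abs_contrast_le {z₀ z₁ : Z} (hz : z₀ ≠ z₁) (a₀ : A) (x : A × Z × Reward) :
    |contrast z₀ z₁ a₀ (5 / 8) x| ≤ 3 := by
  have h1 : (0 : ℝ) ≤ x.2.2 := x.2.2.2.1
  have h2 : (x.2.2 : ℝ) ≤ 1 := x.2.2.2.2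
  have hw : |(if x.2.1 = z₁ then (if x.1 = a₀ then (5 / 8 : ℝ) else 1 / 2)⁻¹ else 0) -
      if x.2.1 = z₀ then (1 - if x.1 = a₀ then (5 / 8 : ℝ) else 1 / 2)⁻¹ else 0| ≤ 3 := by
    split_ifs <;> simp_all <;> norm_num [abs_le]
  rw [contrast, abs_mul, abs_of_nonneg h1]
  nlinarith [abs_nonneg ((if x.2.1 = z₁ then (if x.1 = a₀ then (5 / 8 : ℝ) else 1 / 2)⁻¹ else 0) -
      if x.2.1 = z₀ then (1 - if x.1 = a₀ then (5 / 8 : ℝ) else 1 / 2)⁻¹ else 0)]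

lemma bddMeasurable_contrast {z₀ z₁ : Z} (hz : z₀ ≠ z₁) (a₀ : A) :
    BddMeasurable (contrast z₀ z₁ a₀ (5 / 8) : A × Z × Reward → ℝ) := by
  refine ⟨?_, 3, abs_contrast_le hz a₀⟩
  have hA : Measurable fun x : A × Z × Reward => x.1 := measurable_fst
  have hZ : Measurable fun x : A × Z × Reward => x.2.1 := measurable_fst.comp measurable_snd
  have hi : ∀ f : A → ℝ, Measurable fun x : A × Z × Reward => f x.1 := fun f =>
    (measurable_of_finite f).comp hA
  have hr : Measurable fun x : A × Z × Reward => (x.2.2 : ℝ) :=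
    measurable_subtype_coe.comp (measurable_snd.comp measurable_snd)
  exact hr.mul ((Measurable.ite (hZ (measurableSet_singleton z₁))
    (hi fun a => (if a = a₀ then (5 / 8 : ℝ) else 1 / 2)⁻¹) measurable_const).sub
    (Measurable.ite (hZ (measurableSet_singleton z₀))
    (hi fun a => (1 - if a = a₀ then (5 / 8 : ℝ) else 1 / 2)⁻¹) measurable_const))

/-- Play `a₀` as long as the contrasts of the past rounds have a nonnegative sum, and `a₁`
otherwise. -/
def followTheLeader (T : ℕ) {z₀ z₁ : Z} (hz : z₀ ≠ z₁) (a₀ a₁ : A) : Policy A Z T where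
  act _ h := if 0 ≤ rewardSum (contrast z₀ z₁ a₀ (5 / 8)) h then a₀ else a₁
  measurable_act t := Measurable.ite
    (measurableSet_le measurable_const ((bddMeasurable_contrast hz a₀).rewardSum t).1)
    measurable_const measurable_const

/-- Telescoping: `1/√(t+1) ≤ 2(√(t+1) - √t)`. -/
lemma sum_inv_sqrt_le (T : ℕ) : ∑ t : Fin T, (√((t : ℝ) + 1))⁻¹ ≤ 2 * √T := by
  induction T with
  | zero => simp
  | succ T ih =>
    rw [Fin.sum_univ_castSucc]
    simp only [Fin.val_castSucc, Fin.val_last, Nat.cast_succ]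
    have hx : 0 < √((T : ℝ) + 1) := Real.sqrt_pos.2 (by positivity)
    have hx2 : √((T : ℝ) + 1) ^ 2 = T + 1 := Real.sq_sqrt (by positivity)
    have hy2 : √(T : ℝ) ^ 2 = T := Real.sq_sqrt (by positivity)
    have : (√((T : ℝ) + 1))⁻¹ ≤ 2 * (√((T : ℝ) + 1) - √T) := by
      rw [inv_le_iff_one_le_mul₀ hx]
      nlinarith [sq_nonneg (√((T : ℝ) + 1) - √T)]
    linarith

/-- The mean of `a₀` exceeds the common mean of the other arms by Δ/8, so `a₁` can stand for all of
them. Importance weights from the known marginals make the contrast unbiased for Δ under every arm.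
A wrong leader at round `t` requires a deviation of at least t|Δ|, so the expected loss is of order
1/√(t+1). -/
theorem regret_followTheLeader_le [Nonempty A] {z₀ z₁ : Z} (hz : z₀ ≠ z₁) {a₀ a₁ : A}
    (ha : a₁ ≠ a₀) {r : unitInterval} (hr : (r : ℝ) = 5 / 8) {ν : Environment A Z}
    (hν : ConditionallyBenign ν) (hq : marginals ν = hardMarginals z₀ z₁ a₀ r) :
    regret ν (followTheLeader T hz a₀ a₁) ≤ 20 * √T := by
  obtain ⟨κ, hκ, hint⟩ := hν.integral_eq hq
  rw [hr] at hint
  set π := followTheLeader T hz a₀ a₁ with hπ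
  set m : Z → ℝ := fun z => ∫ y, (y : ℝ) ∂κ z with hm
  have hyint : ∀ z, Integrable (fun y : Reward => (y : ℝ)) (κ z) := fun z =>
    Integrable.of_bound measurable_subtype_coe.aestronglyMeasurable 1
      (ae_of_all _ fun y => by rw [Real.norm_of_nonneg y.2.1]; exact y.2.2)
  have hm0 : ∀ z, 0 ≤ m z := fun z => integral_nonneg fun y => y.2.1
  have hm1 : ∀ z, m z ≤ 1 := fun z => by
    have := integral_mono (hyint z) (integrable_const (1 : ℝ)) fun y => y.2.2
    simpa [hm] using this
  set Δ := m z₁ - m z₀ with hΔ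
  have hmean : ∀ a, meanReward ν a = (if a = a₀ then (5 / 8 : ℝ) else 1 / 2) * m z₁ +
      (1 - if a = a₀ then (5 / 8 : ℝ) else 1 / 2) * m z₀ := fun a =>
    hint a _ bddMeasurable_reward
  let ψ : ℕ → A × Z × Reward → ℝ := fun _ x => contrast z₀ z₁ a₀ (5 / 8) x - Δ
  have hψ : ∀ s, BddMeasurable (ψ s) := fun s =>
    (bddMeasurable_contrast hz a₀).sub (BddMeasurable.const Δ)
  have hψ0 : ∀ s a, ∫ x, ψ s (a, x) ∂(ν a : Measure (Z × Reward)) = 0 := by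
    intro s a
    have h1 := hint a _ ((bddMeasurable_contrast hz a₀).section a)
    simp only [ψ]
    rw [integral_sub (((bddMeasurable_contrast hz a₀).section a).integrable _)
      (integrable_const _), h1, integral_const, probReal_univ, one_smul]
    simp only [contrast, if_true, if_neg hz, if_neg hz.symm, sub_zero, zero_sub]
    split_ifs
    all_goals
      rw [integral_mul_const, integral_mul_const]
      change _ * (m z₁ * _) + _ * (m z₀ * _) - Δ = 0
      rw [hΔ]
      ring
  have hψ2 : ∀ (s : ℕ) x, ψ s x ^ 2 ≤ 16 := fun s x => by
    have h1 := abs_le.1 (abs_contrast_le hz a₀ x)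
    have h2 := hm0 z₀
    have h3 := hm0 z₁
    have h4 := hm1 z₀
    have h5 := hm1 z₁
    simp only [ψ]
    nlinarith
  have hsq : ∀ t : Fin T, π.expect ν t t.isLt.le (fun h => timedSum ψ h ^ 2) ≤ 16 * t := fun t => by
    have := π.expect_timedSum_sq_le ν (n := T) (v := fun _ => 16) hψ hψ2
      (fun t h _ => hψ0 t _) t t.isLt.le t.isLt.le
    simpa [mul_comm] using this
  -- A wrong leader means that the contrast sum and Δ disagree in sign. The shift by 1 on both sides
  -- covers round 0, where there are no data.
  have hgap : ∀ (t : Fin T) h, ((t : ℝ) + 1) * gap ν (π.act t h) ≤ |timedSum ψ h| + 1 := by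
    intro t h
    obtain ⟨b, hb⟩ := exists_gap_eq ν
    have hD : timedSum ψ h = rewardSum (contrast z₀ z₁ a₀ (5 / 8)) h - t * Δ := by
      simp [timedSum, rewardSum, ψ]
    have h2 := hm0 z₀
    have h3 := hm0 z₁
    have h4 := hm1 z₀
    have h5 := hm1 z₁
    have h6 := neg_abs_le (timedSum ψ h)
    have h7 := le_abs_self (timedSum ψ h)
    have h8 := abs_nonneg (timedSum ψ h)
    have ht : (0 : ℝ) ≤ t := Nat.cast_nonneg _
    have hb' := hmean b
    have ha₀ := hmean a₀
    have ha₁ := hmean a₁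
    rw [if_pos rfl] at ha₀
    rw [if_neg ha] at ha₁
    have hact : π.act t h = if 0 ≤ rewardSum (contrast z₀ z₁ a₀ (5 / 8)) h then a₀ else a₁ := rfl
    rw [hact, hb]
    split_ifs with hS
    · rw [ha₀, hb']
      split_ifs with hba
      · nlinarith
      · rcases le_total 0 Δ with hΔ0 | hΔ0 <;> nlinarith
    · rw [ha₁, hb']
      split_ifs with hba
      · rcases le_total 0 Δ with hΔ0 | hΔ0 <;> nlinarith
      · nlinarith
  rw [regret_eq_sum]
  refine (Finset.sum_le_sum (g := fun t : Fin T => 10 * (√((t : ℝ) + 1))⁻¹) fun t _ => ?_).trans ?_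
  · have hw : 1 ≤ √((t : ℝ) + 1) := Real.one_le_sqrt.2 (by simp)
    have hw2 : √((t : ℝ) + 1) ^ 2 = t + 1 := Real.sq_sqrt (by positivity)
    set w := √((t : ℝ) + 1)
    have hw0 : 0 < w := by linarith
    have hD2 := (BddMeasurable.timedSum hψ t).pow 2
    refine (π.expect_mono ν t.isLt.le (bddMeasurable_act π t (gap ν))
      (g := fun h => 1 / (2 * w ^ 3) * timedSum ψ h ^ 2 + (1 / (2 * w) + 1 / w ^ 2))
      (((BddMeasurable.const _).mul hD2).add (BddMeasurable.const _)) fun h => ?_).trans ?_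
    · have h1 := hgap t h
      rw [← hw2] at h1
      -- AM-GM with weight `w = √(t+1)` makes the second moment sufficient.
      have h2 : |timedSum ψ h| ≤ (timedSum ψ h ^ 2 / w + w) / 2 := by
        rw [← sq_abs]
        have : 0 ≤ (|timedSum ψ h| - w) ^ 2 / w := by positivity
        have e : (|timedSum ψ h| - w) ^ 2 / w =
            |timedSum ψ h| ^ 2 / w + w - 2 * |timedSum ψ h| := by field_simp; ring
        linarith
      have h3 : gap ν (π.act t h) ≤ ((timedSum ψ h ^ 2 / w + w) / 2 + 1) / w ^ 2 := by
        rw [le_div_iff₀ (by positivity)]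
        linarith
      refine h3.trans_eq ?_
      field_simp
      ring
    · rw [π.expect_add ν t.isLt.le ((BddMeasurable.const _).mul hD2) (BddMeasurable.const _),
        π.expect_const_mul, π.expect_const]
      have h1 := mul_le_mul_of_nonneg_left (hsq t) (by positivity : 0 ≤ 1 / (2 * w ^ 3))
      have h2 : 1 / (2 * w ^ 3) * (16 * (t : ℝ)) ≤ 8 * w⁻¹ := by
        rw [one_div_mul_eq_div, div_le_iff₀ (by positivity)]
        have : 8 * w⁻¹ * (2 * w ^ 3) = 16 * w ^ 2 := by field_simp; norm_num
        rw [this, hw2]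
        linarith
      have h3 : 1 / (2 * w) = 1 / 2 * w⁻¹ := by field_simp
      have h4 : 1 / w ^ 2 ≤ w⁻¹ := by
        rw [one_div]
        exact inv_anti₀ hw0 (by nlinarith)
      have h5 : 0 < w⁻¹ := inv_pos.2 hw0
      linarith
  · rw [← Finset.mul_sum]
    linarith [sum_inv_sqrt_le T]

end FollowTheLeader

/-! ### Minimax values and the two parts of the theorem -/

section Minimax

variable {A Z : Type} [MeasurableSpace A] [MeasurableSpace Z] {T : ℕ}
  [Fintype A] [DiscreteMeasurableSpace A] [Nonempty A]

lemma regret_le_worstRegret {P : Environment A Z → Prop} {q : A → ProbabilityMeasure Z}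
    (π : Policy A Z T) {ν : Environment A Z} (hq : marginals ν = q) (hP : P ν) :
    regret ν π ≤ worstRegret P q π :=
  le_ciSup (f := fun ν : {ν : Environment A Z // marginals ν = q ∧ P ν} => regret ν.1 π)
    ⟨T, by rintro _ ⟨ν, rfl⟩; exact regret_le ν.1 π⟩ ⟨ν, hq, hP⟩

lemma iInf_worstRegret_le {P : Environment A Z → Prop} {q : A → ProbabilityMeasure Z}
    (π : Policy A Z T) {b : ℝ} (hb : 0 ≤ b)
    (h : ∀ ν : Environment A Z, marginals ν = q → P ν → regret ν π ≤ b) :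
    ⨅ π : Policy A Z T, worstRegret P q π ≤ b := by
  -- The supremum over an empty class is 0, which `hb` covers.
  refine (ciInf_le ⟨0, ?_⟩ π).trans (Real.iSup_le (fun ν => h ν.1 ν.2.1 ν.2.2) hb)
  rintro _ ⟨π, rfl⟩
  exact Real.iSup_nonneg fun ν => regret_nonneg ν.1 π

end Minimax

/-- The choice is δ = K√(|A|/T). As K > 8C, the assumed bound C√(|A|T) lies below δT/8, and T ≥
64K²|A| says that δ ≤ 1/8. -/
theorem exists_benign_regret_ge {C : ℝ} (hC : 0 < C) (𝔞 : Algorithm) (h𝔞 : 𝔞.HasWorstCaseBound C)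
    (A Z : Type) [Fintype A] [Nonempty A] [MeasurableSpace A] [DiscreteMeasurableSpace A]
    [Fintype Z] [MeasurableSpace Z] [DiscreteMeasurableSpace Z] (T : ℕ)
    (hA : 2 ≤ Fintype.card A) (hZ : 2 ≤ Fintype.card Z)
    (hT : 64 * (8 * C + 1) ^ 2 * (Fintype.card A : ℝ) ≤ T) :
    ∃ ν : Environment A Z, ConditionallyBenign ν ∧
      1 / (160 * (8 * C + 1)) * √((Fintype.card A : ℝ) * T) ≤ 𝔞.regret T ν := by
  classical
  obtain ⟨z₀, z₁, hz⟩ := Fintype.exists_pair_of_one_lt_card (α := Z) (by omega)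
  let a₀ : A := Classical.arbitrary A
  set n : ℝ := (Fintype.card A : ℝ) with hn
  have hn2 : (2 : ℝ) ≤ n := by rw [hn]; exact_mod_cast hA
  set K : ℝ := 8 * C + 1 with hK
  have hK1 : 1 ≤ K := by linarith
  have hT0 : (0 : ℝ) < T := lt_of_lt_of_le (by positivity) hT
  set x := √(n * T) with hx
  have hx0 : 0 < x := Real.sqrt_pos.2 (by positivity)
  have hx2 : x ^ 2 = n * T := Real.sq_sqrt (by positivity)
  have hδ0 : 0 < K * x / T := by positivity
  have hδ1 : K * x / T ≤ 1 / 8 := by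
    rw [div_le_iff₀ hT0]
    refine le_of_sq_le_sq ?_ (by positivity)
    rw [mul_pow, hx2]
    nlinarith
  have hδT : K * x / T * T = K * x := by field_simp
  set δ := K * x / T with hδ
  let r : unitInterval := ⟨1 / 2 + δ, by linarith, by linarith⟩
  let s : unitInterval := ⟨1 / 2, by norm_num, by norm_num⟩
  refine ⟨hardEnv z₀ z₁ a₀ r fun _ => s, conditionallyBenign_hardEnv z₀ z₁ a₀ r s, ?_⟩
  have hmarg : marginals (hardEnv z₀ z₁ a₀ r fun _ => s) = hardMarginals z₀ z₁ a₀ r :=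
    marginals_envOf _ _
  have key := regret_hardEnv_ge (𝔞 A Z T (hardMarginals z₀ z₁ a₀ r)) (by exact_mod_cast hT0) hz a₀
    (V := C * x) hδ0 hδ1 r s rfl rfl (fun ν hν => by
      have := h𝔞 A Z T ν
      rwa [Algorithm.regret, hν] at this) (by rw [hδT]; nlinarith)
  rw [Algorithm.regret, hmarg]
  set R := regret (hardEnv z₀ z₁ a₀ r fun _ => s) (𝔞 A Z T (hardMarginals z₀ z₁ a₀ r)) with hR
  have hR0 : 0 ≤ R := regret_nonneg _ _
  have hδ2 : δ ^ 2 = K ^ 2 * n / T := by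
    rw [hδ, div_pow, mul_pow, hx2]
    field_simp
  -- Here δ²T = K²n ≥ 1.
  have h16 : 16 / (T : ℝ) ≤ 16 * δ ^ 2 := by
    rw [hδ2, ← mul_div_assoc]
    exact div_le_div_of_nonneg_right (by nlinarith) hT0.le
  have h1 : δ * (n - 1) ≤ 80 * δ ^ 2 * R := key.trans (by nlinarith)
  have h2 : n - 1 ≤ 80 * δ * R := by
    refine le_of_mul_le_mul_left ?_ hδ0
    linarith
  -- The factor 80 doubles because n - 1 ≥ n/2.
  have h3 : n * T ≤ 160 * K * x * R := by
    have : n ≤ 160 * δ * R := by linarith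
    calc n * T ≤ 160 * δ * R * T := mul_le_mul_of_nonneg_right this hT0.le
      _ = 160 * (δ * T) * R := by ring
      _ = 160 * K * x * R := by rw [hδT]; ring
  rw [← hx2] at h3
  have h4 : x ≤ 160 * K * R := by
    refine le_of_mul_le_mul_left ?_ hx0
    linarith
  rw [one_div_mul_eq_div, div_le_iff₀ (by positivity)]
  linarith

/-- The powers avoid rounding. With m = l⁴N² and η = l²N², exploration costs T/l² and the two error
terms cost 2T/l² and 8T/l². -/
lemma iInf_worstRegret_le_of_pow {Z : Type} [MeasurableSpace Z] {N l : ℕ} (hN : 0 < N) (hl : 0 < l)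
    [Nonempty (Fin (N ^ 4))] (q : Fin (N ^ 4) → ProbabilityMeasure Z) :
    ⨅ π : Policy (Fin (N ^ 4)) Z (N ^ 6 * l ^ 6), worstRegret (fun _ => True) q π ≤
      11 * (N ^ 6 * l ^ 4) := by
  have hN' : (0 : ℝ) < N := by exact_mod_cast hN
  have hl' : (0 : ℝ) < l := by exact_mod_cast hl
  have : NeZero (N ^ 4) := ⟨by positivity⟩
  have hnT : N ^ 4 * (l ^ 4 * N ^ 2) ≤ N ^ 6 * l ^ 6 := by
    calc N ^ 4 * (l ^ 4 * N ^ 2) = N ^ 6 * l ^ 4 := by ring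
      _ ≤ N ^ 6 * l ^ 6 := Nat.mul_le_mul_left _ (Nat.pow_le_pow_right hl (by norm_num))
  obtain ⟨π, hπ⟩ := exists_policy_regret_le (A := Fin (N ^ 4)) (Z := Z) (T := N ^ 6 * l ^ 6)
    (n := N ^ 4 * (l ^ 4 * N ^ 2)) (m := l ^ 4 * N ^ 2) hnT (by positivity)
    (Fin.ofNat (N ^ 4)) (sum_range_mul_ofNat _ _) (η := l ^ 2 * N ^ 2) (by positivity)
  refine iInf_worstRegret_le π (by positivity) fun ν _ _ => (hπ ν).trans_eq ?_
  rw [Fintype.card_fin]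
  push_cast
  field_simp
  ring

theorem not_adaptivelyMinimaxOptimal (𝔞 : Algorithm) :
    ¬ 𝔞.AdaptivelyMinimaxOptimal fun _ _ _ ν => ConditionallyBenign ν := by
  rintro ⟨C, hC, h⟩
  -- Since 704 = 64 · 11, this `l` puts the worst-case bound 11CT/l² below T/64 = δT/8. Then `N` is
  -- chosen to contradict `h1` below.
  obtain ⟨l, hl⟩ := exists_nat_gt (704 * C + 1)
  obtain ⟨N, hN⟩ := exists_nat_gt (2720 * C * l ^ 3 + 2)
  have hl1 : (1 : ℝ) ≤ l := by linarith
  have hN2 : (2 : ℝ) ≤ N := by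
    have : 0 ≤ 2720 * C * (l : ℝ) ^ 3 := by positivity
    linarith
  have hl0 : 0 < l := by
    have : (0 : ℝ) < l := by linarith
    exact_mod_cast this
  have hN2' : 2 ≤ N := by exact_mod_cast hN2
  have hcard : 1 < N ^ 4 := Nat.one_lt_pow (by norm_num) (by omega)
  have : NeZero (N ^ 4) := ⟨by omega⟩
  have : Nontrivial (Fin (N ^ 4)) := Fin.nontrivial_iff_two_le.2 hcard
  obtain ⟨a₁, ha⟩ := exists_ne (0 : Fin (N ^ 4))
  set T := N ^ 6 * l ^ 6 with hT
  have hTR : (T : ℝ) = N ^ 6 * l ^ 6 := by rw [hT]; push_cast; ring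
  have hT1 : (1 : ℝ) ≤ T := by
    rw [hTR]
    exact one_le_mul_of_one_le_of_one_le (one_le_pow₀ (by linarith)) (one_le_pow₀ hl1)
  let r : unitInterval := ⟨5 / 8, by norm_num, by norm_num⟩
  let s : unitInterval := ⟨1 / 2, by norm_num, by norm_num⟩
  let q := hardMarginals false true (0 : Fin (N ^ 4)) r
  obtain ⟨hall, hben⟩ := h (Fin (N ^ 4)) Bool q T
  have hU : ∀ ν : Environment (Fin (N ^ 4)) Bool, marginals ν = q →
      regret ν (𝔞 (Fin (N ^ 4)) Bool T q) ≤ C * (11 * (N ^ 6 * l ^ 4)) := fun ν hν =>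
    (regret_le_worstRegret _ hν trivial).trans (hall.trans
      (mul_le_mul_of_nonneg_left (iInf_worstRegret_le_of_pow (by omega) hl0 q) hC.le))
  have hsqrt : √(T : ℝ) = N ^ 3 * l ^ 3 := by
    rw [hTR, Real.sqrt_eq_iff_mul_self_eq (by positivity) (by positivity)]
    ring
  have hmarg : marginals (hardEnv false true (0 : Fin (N ^ 4)) r fun _ => s) = q :=
    marginals_envOf _ _
  have hB : regret (hardEnv false true (0 : Fin (N ^ 4)) r fun _ => s)
      (𝔞 (Fin (N ^ 4)) Bool T q) ≤ C * (20 * √T) :=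
    (regret_le_worstRegret (P := ConditionallyBenign) _ hmarg
      (conditionallyBenign_hardEnv _ _ _ _ _)).trans (hben.trans
      (mul_le_mul_of_nonneg_left (iInf_worstRegret_le
        (followTheLeader T Bool.false_ne_true 0 a₁) (by positivity) fun ν hν hP =>
          regret_followTheLeader_le Bool.false_ne_true ha rfl hP hν) hC.le))
  have hlt : C * (11 * ((N : ℝ) ^ 6 * l ^ 4)) < 1 / 8 * T / 8 := by
    rw [hTR]
    have h1 : 704 * C < (l : ℝ) ^ 2 := by nlinarith
    have h2 : 0 < (N : ℝ) ^ 6 * l ^ 4 := by positivity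
    have h3 := mul_lt_mul_of_pos_right h1 h2
    linarith
  have key := regret_hardEnv_ge (𝔞 (Fin (N ^ 4)) Bool T q) (by exact_mod_cast hT1)
    Bool.false_ne_true 0 (δ := 1 / 8) (by norm_num) le_rfl r s (by norm_num [r]) rfl hU hlt
  rw [Fintype.card_fin, Nat.cast_pow] at key
  have h16 : 16 / (T : ℝ) ≤ 16 := div_le_self (by norm_num) hT1
  have hR0 := regret_nonneg (hardEnv false true (0 : Fin (N ^ 4)) r fun _ => s)
    (𝔞 (Fin (N ^ 4)) Bool T q)
  rw [hsqrt] at hB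
  -- At δ = 1/8 the factor 64δ² + 16/T is at most 17, and 2720 = 8 · 17 · 20.
  have h1 : (N : ℝ) ^ 4 - 1 ≤ 2720 * C * l ^ 3 * N ^ 3 := by nlinarith
  have h2 : (0 : ℝ) < N ^ 3 := by positivity
  have h3 := mul_lt_mul_of_pos_right hN h2
  have h4 : (8 : ℝ) ≤ N ^ 3 := by
    calc (8 : ℝ) = 2 ^ 3 := by norm_num
      _ ≤ N ^ 3 := pow_le_pow_left₀ (by norm_num) hN2 3
  nlinarith

end CausalBandit

end

theorem mainTheorem2 :
    (∀ C : ℝ, 0 < C → ∃ c C' : ℝ, 0 < c ∧ 0 < C' ∧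
      ∀ 𝔞 : CausalBandit.Algorithm, 𝔞.HasWorstCaseBound C →
        ∀ (A Z : Type) [Fintype A] [Nonempty A] [MeasurableSpace A] [DiscreteMeasurableSpace A]
          [Fintype Z] [MeasurableSpace Z] [DiscreteMeasurableSpace Z] (T : ℕ),
          2 ≤ Fintype.card A → 2 ≤ Fintype.card Z → c * (Fintype.card A : ℝ) ≤ (T : ℝ) →
            ∃ ν : CausalBandit.Environment A Z, CausalBandit.ConditionallyBenign ν ∧
              C' * √((Fintype.card A : ℝ) * T) ≤ 𝔞.regret T ν) ∧
    ¬ ∃ 𝔞 : CausalBandit.Algorithm, 𝔞.AdaptivelyMinimaxOptimal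
        (fun _ _ _ ν => CausalBandit.ConditionallyBenign ν) :=
  ⟨fun C hC => ⟨64 * (8 * C + 1) ^ 2, 1 / (160 * (8 * C + 1)), by positivity, by positivity,
      fun 𝔞 h𝔞 A Z _ _ _ _ _ _ _ T hA hZ hT =>
        CausalBandit.exists_benign_regret_ge hC 𝔞 h𝔞 A Z T hA hZ hT⟩,
    fun ⟨𝔞, h⟩ => CausalBandit.not_adaptivelyMinimaxOptimal 𝔞 h⟩
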